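/- There is an absolute constant $C$ such that every finite simple undirected graph $G$ on $n$ vertices with minimum degree at least $C\log n$ is antimagic; that is, if $m$ denotes the number of edges of $G$, there is a bijection $f\colon E(G)\to\{1,\dots,m\}$ such that the vertex sums $\sum_{e\ni v} f(e)$ (over all edges $e$ incident with $v$), $v\in V(G)$, are pairwise distinct. -/

import Mathlib

namespace SimpleGraph

/-- The vertex sum of `v` under the edge labeling `f`: the sum of the labels of all edges
incident with `v`. Only the values of `f` on edges of `G` matter. -/
def vertexSum {V : Type*} [Fintype V] [DecidableEq V] (G : SimpleGraph V) [DecidableRel G.Adj]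
    (f : Sym2 V → ℕ) (v : V) : ℕ :=
  ∑ e ∈ G.incidenceFinset v, f e

/-- An antimagic labeling: a bijection from the edge set to `{1, …, m}`, where `m` is the number
of edges, such that the vertex sums are pairwise distinct. -/
def IsAntimagicLabeling {V : Type*} [Fintype V] [DecidableEq V] (G : SimpleGraph V)
    [DecidableRel G.Adj] (f : Sym2 V → ℕ) : Prop :=
  Set.BijOn f G.edgeSet (Set.Icc 1 G.edgeFinset.card) ∧ Function.Injective (G.vertexSum f)

/-- A graph is antimagic if it has an antimagic labeling. -/
def IsAntimagic {V : Type*} [Fintype V] [DecidableEq V] (G : SimpleGraph V)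
    [DecidableRel G.Adj] : Prop :=
  ∃ f : Sym2 V → ℕ, G.IsAntimagicLabeling f

end SimpleGraph

/-! The logarithm is not needed: minimum degree at least `10 ^ 15` already suffices, and `theorem1`
only converts the hypothesis.

Hall's theorem gives every vertex three private incident edges. The first ones span a graph `H`
without isolated vertices, hence with a spanning forest of nontrivial stars. The stars are cut into
gadgets of one or two edges, and these are grouped into `N` rows of four edges carrying the signs `+
+ - -`. Each vertex `v` is affected by at most one row, called `ρ v`, and all but twenty vertices
are affected (`exists_rowSystem`).

The rows receive the labels `k, 2k, ..., 4Nk`, arranged in `N` columns that move with their index in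
the directions of the signs. If row `i` takes column `π i`, the sum at `v` is `W v + k * σ v * π (ρ
v)`, where `σ v` is the effect of row `ρ v` on `v` and `W` does not depend on `π`.

The other labels are placed at random on the other edges. The second and third private edges ensure
that the difference of two sums really varies, so `W u` and `W v` agree modulo `k` with probability
`O(1/k)`. By Markov's inequality some placement has few such pairs, and no equality `W u = W v`
inside a row (`exists_perm_few_coincidences`).

Finally `π` is chosen. Only pairs congruent modulo `k` can collide, and each forbids at most `N` of
the `N ^ 2` ways of choosing two columns. For `k = 10 ^ 14` these forbidden cell pairs are sparse in
every row and column, so the lopsided local lemma for random permutations avoids them all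
(`exists_perm_avoiding`, `exists_perm_injective`). -/

open Finset

/-! ### The lopsided local lemma for random permutations -/

section LocalLemma

variable {ι J : Type*} [Fintype ι] [DecidableEq ι]

/-- The permutations realising none of the cell pairs indexed by `S`. -/
def avoidingPerms (r₁ r₂ c₁ c₂ : J → ι) (S : Finset J) : Finset (Equiv.Perm ι) :=
  {π | ∀ j ∈ S, ¬(π (r₁ j) = c₁ j ∧ π (r₂ j) = c₂ j)}

/-- Exchanging the value at one position cannot create an avoided cell pair that uses neither
this position nor the old value. -/
theorem card_avoidingPerms_swap_le (r₁ r₂ c₁ c₂ : J → ι) (S : Finset J) (i t s : ι)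
    (P : Finset (Equiv.Perm ι))
    (hP : ∀ π ∈ P, Equiv.swap t s * π ∈ P)
    (hS : ∀ j ∈ S, r₁ j ≠ i ∧ r₂ j ≠ i ∧ c₁ j ≠ t ∧ c₂ j ≠ t) :
    #{π ∈ avoidingPerms r₁ r₂ c₁ c₂ S | π ∈ P ∧ π i = t} ≤
      #{π ∈ avoidingPerms r₁ r₂ c₁ c₂ S | π ∈ P ∧ π i = s} := by
  refine Finset.card_le_card_of_injOn (fun π => Equiv.swap t s * π) ?_
    (fun _ _ _ _ h => mul_left_cancel h)
  intro π hπ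
  simp only [avoidingPerms, coe_filter, mem_filter, mem_univ, true_and, Set.mem_ofPred_eq] at hπ ⊢
  obtain ⟨hav, hmem, hi⟩ := hπ
  refine ⟨fun j hj h => hav j hj ?_, hP π hmem, by simp [hi]⟩
  obtain ⟨h1, h2, h3, h4⟩ := hS j hj
  -- Landing on `s` after the exchange would mean `π r = t = π i`, hence `r = i`. Every other cell
  -- with column different from `t` was already hit before.
  have key : ∀ r c, r ≠ i → c ≠ t → (Equiv.swap t s * π) r = c → π r = c := by
    intro r c hr hc h
    have h' : π r = Equiv.swap t s c := by
      rw [← h]; simp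
    by_cases hcs : c = s
    · subst hcs
      rw [Equiv.swap_apply_right] at h'
      exact absurd (π.injective (h'.trans hi.symm)) hr
    · rwa [Equiv.swap_apply_of_ne_of_ne hc hcs] at h'
  exact ⟨key _ _ h1 h3 h.1, key _ _ h2 h4 h.2⟩

/-- Negative dependence of a cell pair on cell pairs in other rows and columns. -/
theorem card_mul_card_avoidingPerms_le (r₁ r₂ c₁ c₂ : J → ι) (S : Finset J) (i i' t t' : ι)
    (hi : i ≠ i')
    (hS : ∀ j ∈ S, r₁ j ≠ i ∧ r₂ j ≠ i ∧ c₁ j ≠ t ∧ c₂ j ≠ t)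
    (hS' : ∀ j ∈ S, r₁ j ≠ i' ∧ r₂ j ≠ i' ∧ c₁ j ≠ t' ∧ c₂ j ≠ t') :
    Fintype.card ι * (Fintype.card ι - 1) *
        #{π ∈ avoidingPerms r₁ r₂ c₁ c₂ S | π i = t ∧ π i' = t'} ≤
      #(avoidingPerms r₁ r₂ c₁ c₂ S) := by
  classical
  by_cases htt : t = t'
  · have : #{π ∈ avoidingPerms r₁ r₂ c₁ c₂ S | π i = t ∧ π i' = t'} = 0 := by
      rw [Finset.card_eq_zero, Finset.filter_eq_empty_iff]
      rintro π - ⟨h1, h2⟩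
      exact hi (π.injective (h1.trans (htt.trans h2.symm)))
    simp [this]
  set A := avoidingPerms r₁ r₂ c₁ c₂ S with hA
  have first : Fintype.card ι * #{π ∈ A | π i = t} ≤ #A := by
    calc Fintype.card ι * #{π ∈ A | π i = t}
        = ∑ _s : ι, #{π ∈ A | π i = t} := by simp
      _ ≤ ∑ s : ι, #{π ∈ A | π i = s} := by
          refine Finset.sum_le_sum fun s _ => ?_
          simpa using card_avoidingPerms_swap_le r₁ r₂ c₁ c₂ S i t s Finset.univ (by simp) hS
      _ = #A := (Finset.card_eq_sum_card_fiberwise (f := fun π : Equiv.Perm ι => π i)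
          (t := Finset.univ) (fun _ _ => by simp)).symm
  have second : (Fintype.card ι - 1) * #{π ∈ A | π i = t ∧ π i' = t'} ≤ #{π ∈ A | π i = t} := by
    calc (Fintype.card ι - 1) * #{π ∈ A | π i = t ∧ π i' = t'}
        = ∑ _s ∈ Finset.univ.erase t, #{π ∈ A | π i = t ∧ π i' = t'} := by
          simp [Finset.card_erase_of_mem]
      _ ≤ ∑ s ∈ Finset.univ.erase t, #{π ∈ A | π i = t ∧ π i' = s} := by
          refine Finset.sum_le_sum fun s hs => ?_
          have hst : s ≠ t := (Finset.mem_erase.1 hs).1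
          simpa using card_avoidingPerms_swap_le r₁ r₂ c₁ c₂ S i' t' s
            -- The exchange at `i'` must preserve `π i = t`, so `t` is not an admissible new value.
            -- This leaves the factor `N - 1`, where `N` is the size of `ι`.
            (Finset.univ.filter fun π : Equiv.Perm ι => π i = t) (by
              intro π hπ
              simp only [mem_filter, mem_univ, true_and] at hπ ⊢
              rw [Equiv.Perm.mul_apply, hπ, Equiv.swap_apply_of_ne_of_ne htt hst.symm]) hS'
      _ = #{π ∈ A | π i = t} := by
          rw [Finset.card_eq_sum_card_fiberwise (f := fun π : Equiv.Perm ι => π i')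
            (t := Finset.univ.erase t)]
          · simp only [Finset.filter_filter]
          · intro π hπ
            simp only [coe_filter, Set.mem_ofPred_eq] at hπ
            simp only [coe_erase, coe_univ, Set.mem_sdiff, Set.mem_univ, Set.mem_singleton_iff,
              true_and]
            intro h
            exact hi (π.injective (hπ.2.trans h.symm))
  calc _ = Fintype.card ι * ((Fintype.card ι - 1) * #{π ∈ A | π i = t ∧ π i' = t'}) := by ring
    _ ≤ Fintype.card ι * #{π ∈ A | π i = t} := Nat.mul_le_mul_left _ second
    _ ≤ _ := first

/-- Lopsided local lemma for random permutations: conditionally on avoiding other cell pairs, a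
cell pair is at most twice as likely as unconditionally. -/
theorem card_avoidingPerms_filter_le (r₁ r₂ c₁ c₂ : J → ι) (E : Finset J)
    (hr : ∀ j ∈ E, r₁ j ≠ r₂ j) (K : ℕ)
    (hrow : ∀ i, #{j ∈ E | r₁ j = i ∨ r₂ j = i} ≤ K)
    (hcol : ∀ t, #{j ∈ E | c₁ j = t ∨ c₂ j = t} ≤ K)
    (hK : 16 * K ≤ Fintype.card ι * (Fintype.card ι - 1)) (S : Finset J) :
    S ⊆ E → ∀ a ∈ E, Fintype.card ι * (Fintype.card ι - 1) *
        #{π ∈ avoidingPerms r₁ r₂ c₁ c₂ S | π (r₁ a) = c₁ a ∧ π (r₂ a) = c₂ a} ≤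
      2 * #(avoidingPerms r₁ r₂ c₁ c₂ S) := by
  classical
  induction S using Finset.strongInduction with
  | H S ih =>
  intro hSE a ha
  let near : J → Prop := fun j =>
    ((r₁ j = r₁ a ∨ r₂ j = r₁ a) ∨ (r₁ j = r₂ a ∨ r₂ j = r₂ a)) ∨
      ((c₁ j = c₁ a ∨ c₂ j = c₁ a) ∨ (c₁ j = c₂ a ∨ c₂ j = c₂ a))
  set S₁ := S.filter near with hS₁
  set S₂ := S.filter fun j => ¬ near j with hS₂
  have hS₂S : S₂ ⊆ S := Finset.filter_subset _ _
  have hlop := card_mul_card_avoidingPerms_le r₁ r₂ c₁ c₂ S₂ (r₁ a) (r₂ a) (c₁ a) (c₂ a) (hr a ha)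
    (fun j hj => by simp only [hS₂, near, mem_filter] at hj; tauto)
    (fun j hj => by simp only [hS₂, near, mem_filter] at hj; tauto)
  have hmono : avoidingPerms r₁ r₂ c₁ c₂ S ⊆ avoidingPerms r₁ r₂ c₁ c₂ S₂ := by
    intro π hπ
    simp only [avoidingPerms, mem_filter, mem_univ, true_and] at hπ ⊢
    exact fun j hj => hπ j (hS₂S hj)
  have hle : Fintype.card ι * (Fintype.card ι - 1) *
      #{π ∈ avoidingPerms r₁ r₂ c₁ c₂ S | π (r₁ a) = c₁ a ∧ π (r₂ a) = c₂ a} ≤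
      #(avoidingPerms r₁ r₂ c₁ c₂ S₂) :=
    (Nat.mul_le_mul_left _ (Finset.card_le_card (Finset.filter_subset_filter _ hmono))).trans hlop
  refine hle.trans ?_
  by_cases hempty : S₁ = ∅
  · have : S₂ = S := by
      have h := Finset.filter_union_filter_not_eq near S
      rw [← hS₁, ← hS₂, hempty, Finset.empty_union] at h
      exact h
    rw [this]; omega
  have hss : S₂ ⊂ S := by
    refine Finset.ssubset_iff_subset_ne.2 ⟨hS₂S, fun h => hempty ?_⟩
    rw [hS₁, Finset.filter_eq_empty_iff]
    intro j hj
    rw [← h, hS₂] at hj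
    exact (Finset.mem_filter.1 hj).2
  -- The cell pair `a` has two rows and two columns, each met by at most `K` pairs.
  have hcardS₁ : #S₁ ≤ 4 * K := by
    have hsub : S₁ ⊆ ((E.filter fun j => r₁ j = r₁ a ∨ r₂ j = r₁ a) ∪
        (E.filter fun j => r₁ j = r₂ a ∨ r₂ j = r₂ a)) ∪
        ((E.filter fun j => c₁ j = c₁ a ∨ c₂ j = c₁ a) ∪
        (E.filter fun j => c₁ j = c₂ a ∨ c₂ j = c₂ a)) := by
      intro j hj
      obtain ⟨hjS, hnear⟩ := Finset.mem_filter.1 hj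
      have hjE := hSE hjS
      simp only [mem_union, mem_filter, hjE, true_and]
      exact hnear
    have h1 := hrow (r₁ a)
    have h2 := hrow (r₂ a)
    have h3 := hcol (c₁ a)
    have h4 := hcol (c₂ a)
    refine (Finset.card_le_card hsub).trans ((Finset.card_union_le _ _).trans ?_)
    refine (Nat.add_le_add (Finset.card_union_le _ _) (Finset.card_union_le _ _)).trans ?_
    omega
  set A₂ := avoidingPerms r₁ r₂ c₁ c₂ S₂ with hA₂
  have hcover : A₂ ⊆ avoidingPerms r₁ r₂ c₁ c₂ S ∪
      S₁.biUnion fun b => A₂.filter fun π => π (r₁ b) = c₁ b ∧ π (r₂ b) = c₂ b := by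
    intro π hπ
    by_cases h : π ∈ avoidingPerms r₁ r₂ c₁ c₂ S
    · exact Finset.mem_union_left _ h
    · refine Finset.mem_union_right _ ?_
      simp only [avoidingPerms, mem_filter, mem_univ, true_and, not_forall, not_not] at h
      obtain ⟨b, hbS, hb⟩ := h
      simp only [mem_biUnion, mem_filter]
      refine ⟨b, ?_, hπ, hb⟩
      rw [hS₁, mem_filter]
      refine ⟨hbS, ?_⟩
      by_contra hnb
      have hπ' := hπ
      simp only [hA₂, avoidingPerms, mem_filter, mem_univ, true_and] at hπ'
      exact hπ' b (by rw [hS₂, mem_filter]; exact ⟨hbS, hnb⟩) hb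
  have hsum : #A₂ ≤ #(avoidingPerms r₁ r₂ c₁ c₂ S) +
      ∑ b ∈ S₁, #(A₂.filter fun π => π (r₁ b) = c₁ b ∧ π (r₂ b) = c₂ b) :=
    (Finset.card_le_card hcover).trans ((Finset.card_union_le _ _).trans
      (Nat.add_le_add_left Finset.card_biUnion_le _))
  have hsum' : Fintype.card ι * (Fintype.card ι - 1) *
      ∑ b ∈ S₁, #(A₂.filter fun π => π (r₁ b) = c₁ b ∧ π (r₂ b) = c₂ b) ≤
      8 * K * #A₂ := by
    rw [Finset.mul_sum]
    calc _ ≤ ∑ _b ∈ S₁, 2 * #A₂ := by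
          refine Finset.sum_le_sum fun b hb => ?_
          exact ih S₂ hss (hS₂S.trans hSE) b (hSE (Finset.mem_filter.1 hb).1)
      _ = #S₁ * (2 * #A₂) := by simp
      _ ≤ 4 * K * (2 * #A₂) := Nat.mul_le_mul_right _ hcardS₁
      _ = _ := by ring
  have hpos : 0 < Fintype.card ι * (Fintype.card ι - 1) := by
    have : Nontrivial ι := ⟨⟨r₁ a, r₂ a, hr a ha⟩⟩
    have := Fintype.one_lt_card (α := ι)
    exact Nat.mul_pos (by omega) (by omega)
  set M := Fintype.card ι * (Fintype.card ι - 1)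
  set s := ∑ b ∈ S₁, #(A₂.filter fun π => π (r₁ b) = c₁ b ∧ π (r₂ b) = c₂ b)
  -- By induction each near pair has conditional probability at most `2 / M`. Together they cover at
  -- most `8 * K / M ≤ 1 / 2` of `A₂`, so avoiding them at worst halves the count; this is the
  -- factor two in the claim.
  have : 2 * s ≤ #A₂ := by
    refine Nat.le_of_mul_le_mul_left ?_ hpos
    nlinarith
  omega

/-- If every row and every column occurs in few forbidden cell pairs, then some permutation
avoids all of them. -/
theorem exists_perm_avoiding (r₁ r₂ c₁ c₂ : J → ι) (E : Finset J)
    (hr : ∀ j ∈ E, r₁ j ≠ r₂ j) (K : ℕ)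
    (hrow : ∀ i, #{j ∈ E | r₁ j = i ∨ r₂ j = i} ≤ K)
    (hcol : ∀ t, #{j ∈ E | c₁ j = t ∨ c₂ j = t} ≤ K)
    (hK : 16 * K ≤ Fintype.card ι * (Fintype.card ι - 1)) :
    ∃ π : Equiv.Perm ι, ∀ j ∈ E, ¬(π (r₁ j) = c₁ j ∧ π (r₂ j) = c₂ j) := by
  classical
  suffices h : ∀ S : Finset J, S ⊆ E → 0 < #(avoidingPerms r₁ r₂ c₁ c₂ S) by
    obtain ⟨π, hπ⟩ := Finset.card_pos.1 (h E subset_rfl)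
    exact ⟨π, by simpa [avoidingPerms] using hπ⟩
  intro S
  induction S using Finset.induction_on with
  | empty => intro _; exact Finset.card_pos.2 ⟨1, by simp [avoidingPerms]⟩
  | insert a S _ ih =>
    intro hS
    have haE : a ∈ E := hS (Finset.mem_insert_self _ _)
    have hSE : S ⊆ E := (Finset.subset_insert _ _).trans hS
    have hpos := ih hSE
    have hK1 : 1 ≤ K := (Finset.card_pos.2 ⟨a, by simp [haE]⟩).trans_le (hrow (r₁ a))
    have hle := card_avoidingPerms_filter_le r₁ r₂ c₁ c₂ E hr K hrow hcol hK S hSE a haE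
    have hsplit : avoidingPerms r₁ r₂ c₁ c₂ (insert a S) =
        (avoidingPerms r₁ r₂ c₁ c₂ S).filter
          fun π => ¬(π (r₁ a) = c₁ a ∧ π (r₂ a) = c₂ a) := by
      ext π
      simp only [avoidingPerms, mem_insert, forall_eq_or_imp, mem_filter, mem_univ, true_and]
      tauto
    have hadd := Finset.card_filter_add_card_filter_not (s := avoidingPerms r₁ r₂ c₁ c₂ S)
      (fun π : Equiv.Perm ι => π (r₁ a) = c₁ a ∧ π (r₂ a) = c₂ a)
    rw [hsplit]
    have h16 : 16 ≤ Fintype.card ι * (Fintype.card ι - 1) := by omega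
    by_contra hzero
    have hz := Nat.eq_zero_of_not_pos hzero
    rw [hz, add_zero] at hadd
    rw [hadd] at hle
    nlinarith

end LocalLemma

/-! ### Anticoncentration under random placement of labels -/

section RandomLabels

variable {α : Type*} [Fintype α] [DecidableEq α]

/-- Only the positions `a` and `b` notice the swap, and `b` carries no weight, so all the change
comes from the new value at `a`. -/
theorem sum_mul_comp_swap (coef g : α → ℤ) (τ : Equiv.Perm α) {a b : α} (ha : coef a = 1)
    (hb : coef b = 0) :
    ∑ e, coef e * g ((τ * Equiv.swap a b) e) =
      (∑ e, coef e * g (τ e)) - g (τ a) + g (τ b) := by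
  have hab : a ≠ b := by rintro rfl; omega
  have h : ∀ e, coef e * g ((τ * Equiv.swap a b) e) =
      coef e * g (τ e) + if e = a then g (τ b) - g (τ a) else 0 := by
    intro e
    by_cases hea : e = a
    · subst hea; simp [ha]
    · by_cases heb : e = b
      · subst heb; simp [hb, hea]
      · simp [Equiv.swap_apply_of_ne_of_ne hea heb, hea]
  rw [Finset.sum_congr rfl fun e _ => h e, Finset.sum_add_distrib]
  simp; ring

/-- Anticoncentration of a linear form with a coefficient `1` and many zero coefficients at a
uniformly random arrangement of the values `g`. -/
theorem card_perm_filter_mul_le (coef g : α → ℤ) (T : ℤ → Prop) [DecidablePred T] {a : α}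
    (ha : coef a = 1) (M : ℕ) (hM : ∀ c, #{b | T (c + g b)} ≤ M) :
    #{τ : Equiv.Perm α | T (∑ e, coef e * g (τ e))} * #{b | coef b = 0} ≤
      Fintype.card (Equiv.Perm α) * M := by
  calc #{τ : Equiv.Perm α | T (∑ e, coef e * g (τ e))} * #{b | coef b = 0}
      = ∑ b with coef b = 0, #{τ : Equiv.Perm α | T (∑ e, coef e * g (τ e))} := by
        simp [mul_comm]
    _ = ∑ b with coef b = 0, ∑ τ : Equiv.Perm α,
          if T ((∑ e, coef e * g (τ e)) - g (τ a) + g (τ b)) then 1 else 0 := by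
        refine Finset.sum_congr rfl fun b hb => ?_
        -- Composing with a swap permutes the arrangements, so every `b` gives the same count.
        -- Averaging over `b` with `τ` fixed, the value entering at `a` runs through distinct
        -- labels, and at most `M` of them are hits.
        rw [Finset.card_filter, ← Equiv.sum_comp (Equiv.mulRight (Equiv.swap a b))]
        refine Finset.sum_congr rfl fun τ _ => ?_
        rw [Equiv.coe_mulRight, sum_mul_comp_swap coef g τ ha (Finset.mem_filter.1 hb).2]
    _ = ∑ τ : Equiv.Perm α, ∑ b with coef b = 0,
          if T ((∑ e, coef e * g (τ e)) - g (τ a) + g (τ b)) then 1 else 0 := Finset.sum_comm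
    _ ≤ ∑ τ : Equiv.Perm α, M := by
        refine Finset.sum_le_sum fun τ _ => ?_
        refine le_trans ?_ (hM ((∑ e, coef e * g (τ e)) - g (τ a)))
        rw [Finset.card_filter, 
          ← Equiv.sum_comp τ (fun b => if T ((∑ e, coef e * g (τ e)) - g (τ a) + g b) then 1 else 0)]
        exact Finset.sum_le_sum_of_subset (Finset.subset_univ _)
    _ = _ := by simp

end RandomLabels

/-- At most `m / k + 1` elements of `{1, …, m}` lie in a given residue class modulo `k`. -/
theorem card_filter_dvd_add_le {α : Type*} [Fintype α] (g : α → ℤ) (hg : Function.Injective g)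
    (m k : ℕ) (hgm : ∀ b, 1 ≤ g b ∧ g b ≤ m) (c : ℤ) :
    #{b | (k : ℤ) ∣ c + g b} ≤ m / k + 1 := by
  classical
  have h := Finset.card_le_card_of_injOn (s := univ.filter fun b => (k : ℤ) ∣ c + g b)
    (t := (Finset.range (m / k + 1))) (fun b => ((g b).toNat / k)) ?_ ?_
  · simpa using h
  · intro b hb
    simp only [coe_range, Set.mem_Iio]
    have := (hgm b).2
    have h2 : (g b).toNat ≤ m := by omega
    exact Nat.lt_succ_of_le (Nat.div_le_div_right h2)
  · intro b hb b' hb' h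
    simp only [coe_filter, mem_univ, true_and, Set.mem_ofPred_eq] at hb hb' h
    apply hg
    have h1 := (hgm b).1
    have h1' := (hgm b').1
    have hd : (k : ℤ) ∣ g b - g b' := by
      have := dvd_sub hb hb'
      simpa using this
    obtain ⟨x, hx⟩ : ∃ x : ℕ, g b = x := ⟨(g b).toNat, by omega⟩
    obtain ⟨y, hy⟩ : ∃ y : ℕ, g b' = y := ⟨(g b').toNat, by omega⟩
    rw [hx, hy] at h hd ⊢
    simp only [Int.toNat_natCast] at h
    have hmod : x % k = y % k := by
      have : (y : ℤ) ≡ x [ZMOD k] := Int.modEq_iff_dvd.2 hd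
      exact ((Int.natCast_modEq_iff).1 this).symm
    have e1 := Nat.div_add_mod x k
    have e2 := Nat.div_add_mod y k
    rw [h, hmod] at e1
    exact_mod_cast e1.symm.trans e2

/-! ### Spanning forests of nontrivial stars -/

section StarForest

variable {V : Type*} [Fintype V]

/-- A graph without isolated vertices has a spanning forest of nontrivial stars, given here by the
map `c` sending each vertex to the centre of its star. -/
theorem exists_spanning_starForest (H : SimpleGraph V) (hH : ∀ v, ∃ u, H.Adj v u) :
    ∃ c : V → V, (∀ v, c (c v) = c v) ∧ (∀ v, c v ≠ v → H.Adj v (c v)) ∧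
      ∀ v, ∃ u, u ≠ v ∧ c u = c v := by
  classical
  let good : (V → V) → Prop := fun c => (∀ v, c (c v) = c v) ∧ ∀ v, c v ≠ v → H.Adj v (c v)
  let lone : (V → V) → Finset V := fun c => {v | ∀ u, c u = c v → u = v}
  obtain ⟨c, hc, hmin⟩ := Finset.exists_min_image (univ.filter good) (fun c => #(lone c))
    ⟨id, by simp [good]⟩
  have hcg : good c := (mem_filter.1 hc).2
  refine ⟨c, hcg.1, hcg.2, ?_⟩
  by_contra hcon
  push Not at hcon
  obtain ⟨v, hv⟩ := hcon
  have hvl : ∀ u, c u = c v → u = v := fun u hu => by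
    by_contra h; exact hv u h hu
  have hcv : c v = v := hvl _ (hcg.1 v)
  obtain ⟨y, hy⟩ := hH v
  have hvy : v ≠ y := hy.ne
  -- In a star forest with fewest one-vertex stars, a remaining lone vertex `v` is absorbed into a
  -- star with its neighbour `y` without making any other vertex lone. If `y` is a centre, `v` joins
  -- it. If `y` is a leaf of a star with another leaf, `y` leaves it and becomes the centre for `v`.
  -- Otherwise the star is a single edge and is recentred at `y`.
  suffices h : ∃ c', good c' ∧ (∀ x, (∀ u, c' u = c' x → u = x) → ∀ u, c u = c x → u = x) ∧
      c' y = c' v by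
    obtain ⟨c', hg, hsub, hyv⟩ := h
    have h1 := hmin c' (mem_filter.2 ⟨mem_univ _, hg⟩)
    have h2 : lone c' ⊂ lone c := by
      rw [Finset.ssubset_iff_of_subset]
      · exact ⟨v, by simpa [lone] using hvl, by simpa [lone] using ⟨y, hyv, hvy.symm⟩⟩
      · intro x hx
        simp only [lone, mem_filter, mem_univ, true_and] at hx ⊢
        exact hsub x hx
    exact absurd (Finset.card_lt_card h2) (by omega)
  obtain ⟨hg1, hg2⟩ := hcg
  by_cases hyy : c y = y
  · refine ⟨Function.update c v y, ⟨?_, ?_⟩, ?_, ?_⟩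
    · grind
    · grind
    · intro x hx u hu
      have h4 := hx v
      have h5 := hx u
      have h6 := hx y
      grind
    · grind
  · by_cases hz : ∃ u, u ≠ y ∧ u ≠ c y ∧ c u = c y
    · obtain ⟨u₀, h1, h2, h3⟩ := hz
      refine ⟨Function.update (Function.update c v y) y y, ⟨?_, ?_⟩, ?_, ?_⟩
      · grind
      · grind
      · intro x hx u hu
        have := hg1 y
        have h4 := hx y
        have h5 := hx u₀
        have h6 := hx (c y)
        have h7 := hx u
        have h8 := hx v
        grind
      · grind
    · push Not at hz
      have hadj := hg2 y hyy
      refine ⟨Function.update (Function.update (Function.update c v y) y y) (c y) y,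
        ⟨?_, ?_⟩, ?_, ?_⟩
      · grind
      · intro x hx
        have := hadj.symm
        grind
      · intro x hx u hu
        have := hg1 y
        have h4 := hx y
        have h6 := hx (c y)
        have h7 := hx u
        have h8 := hx v
        grind
      · grind

end StarForest

/-! ### Cutting stars into gadgets -/

section Gadgets

variable {V : Type*} [DecidableEq V]

/-- Incidence of a vertex with an edge, as an integer. -/
def incidence (v : V) (e : Sym2 V) : ℤ := if v ∈ e then 1 else 0

/-- One or two edges whose labels are moved simultaneously, in opposite or parallel directions. -/
inductive LabelGadget (V : Type*)
  | single (e : Sym2 V)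
  | opposite (e e' : Sym2 V)
  | parallel (e e' : Sym2 V)

namespace LabelGadget

/-- The edges of a gadget. -/
def edges : LabelGadget V → List (Sym2 V)
  | single e => [e]
  | opposite e e' => [e, e']
  | parallel e e' => [e, e']

/-- The rate at which the sum at `v` changes when the labels of the gadget are moved. -/
def effect (v : V) : LabelGadget V → ℤ
  | single e => incidence v e
  | opposite e e' => incidence v e - incidence v e'
  | parallel e e' => incidence v e + incidence v e'

theorem exists_mem_of_effect_ne_zero {v : V} {a : LabelGadget V} (h : a.effect v ≠ 0) :
    ∃ e ∈ a.edges, v ∈ e := by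
  cases a <;> simp only [effect, incidence, edges] at * <;> grind

/-- No vertex is affected by both gadgets. -/
def Independent (a b : LabelGadget V) : Prop := ∀ v, a.effect v = 0 ∨ b.effect v = 0

theorem Independent.symm {a b : LabelGadget V} (h : a.Independent b) : b.Independent a :=
  fun v => (h v).symm

/-- A list of edge-disjoint gadgets inside `U` affecting every vertex of `U` exactly once. -/
structure IsCover (H : SimpleGraph V) (U : Finset V) (us : List (LabelGadget V)) : Prop where
  mem_edgeSet : ∀ a ∈ us, ∀ e ∈ a.edges, e ∈ H.edgeSet
  mem_support : ∀ a ∈ us, ∀ e ∈ a.edges, ∀ v ∈ e, v ∈ U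
  nodup : (us.flatMap edges).Nodup
  pairwise : us.Pairwise Independent
  cover : ∀ v ∈ U, ∃ a ∈ us, a.effect v ≠ 0

/-- `X` is the set of vertices settled by the new gadget. Its edges may reach outside `X`, but each
touches `X`, which the other gadgets avoid entirely; this yields edge-disjointness and independence.
-/
theorem IsCover.cons {H : SimpleGraph V} {U X : Finset V} {us : List (LabelGadget V)}
    (h : IsCover H (U \ X) us) (a : LabelGadget V)
    (hmem : ∀ e ∈ a.edges, e ∈ H.edgeSet) (hsup : ∀ e ∈ a.edges, ∀ v ∈ e, v ∈ U)
    (hnd : a.edges.Nodup) (hX : ∀ e ∈ a.edges, ∃ v ∈ e, v ∈ X)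
    (heff : ∀ v, a.effect v ≠ 0 ↔ v ∈ X) : IsCover H U (a :: us) where
  mem_edgeSet := by
    intro b hb
    rcases List.mem_cons.1 hb with rfl | hb
    exacts [hmem, h.mem_edgeSet b hb]
  mem_support := by
    intro b hb
    rcases List.mem_cons.1 hb with rfl | hb
    · exact hsup
    · exact fun e he v hv => (Finset.mem_sdiff.1 (h.mem_support b hb e he v hv)).1
  nodup := by
    rw [List.flatMap_cons]
    refine List.Nodup.append hnd h.nodup ?_
    intro e he he'
    obtain ⟨b, hb, heb⟩ := List.mem_flatMap.1 he'
    obtain ⟨v, hv, hvX⟩ := hX e he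
    exact (Finset.mem_sdiff.1 (h.mem_support b hb e heb v hv)).2 hvX
  pairwise := by
    refine List.pairwise_cons.2 ⟨fun b hb v => ?_, h.pairwise⟩
    by_contra hcon
    push Not at hcon
    obtain ⟨e, he, hv⟩ := exists_mem_of_effect_ne_zero hcon.2
    exact (Finset.mem_sdiff.1 (h.mem_support b hb e he v hv)).2 ((heff v).1 hcon.1)
  cover := by
    intro v hv
    by_cases hvX : v ∈ X
    · exact ⟨a, by simp, (heff v).2 hvX⟩
    · obtain ⟨b, hb, hbv⟩ := h.cover v (Finset.mem_sdiff.2 ⟨hv, hvX⟩)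
      exact ⟨b, by simp [hb], hbv⟩

/-- Gadgets are peeled off one star at a time. A star with one leaf is a `single`, and one with two
leaves is a `parallel`, whose centre has effect two. With three or more leaves, two leaf edges form
an `opposite` gadget: the effects cancel at the centre, which stays behind with a smaller nontrivial
star. -/
theorem exists_isCover_of_starForest {H : SimpleGraph V} {c : V → V}
    (hc : ∀ v, c (c v) = c v) (hadj : ∀ v, c v ≠ v → H.Adj v (c v)) (U : Finset V) :
    (∀ v ∈ U, c v ∈ U) → (∀ v ∈ U, ∃ u ∈ U, u ≠ v ∧ c u = c v) →
      ∃ us : List (LabelGadget V), IsCover H U us := by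
  induction U using Finset.strongInduction with
  | H U ih =>
  intro hcl hne
  rcases U.eq_empty_or_nonempty with rfl | ⟨v₀, hv₀⟩
  · exact ⟨[], by constructor <;> simp⟩
  obtain ⟨z, hz, hzc⟩ : ∃ z ∈ U, c z = z := ⟨c v₀, hcl _ hv₀, hc _⟩
  set L := U.filter fun u => u ≠ z ∧ c u = z with hL
  have hmemL : ∀ u, u ∈ L ↔ u ∈ U ∧ u ≠ z ∧ c u = z := fun u => by simp [hL]
  have hadjL : ∀ u ∈ L, H.Adj u z := fun u hu => by
    obtain ⟨-, h1, h2⟩ := (hmemL u).1 hu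
    have := hadj u (by rw [h2]; exact h1.symm)
    rwa [h2] at this
  have hLne : L.Nonempty := by
    obtain ⟨u, hu, hu1, hu2⟩ := hne z hz
    exact ⟨u, (hmemL u).2 ⟨hu, hu1, hu2.trans hzc⟩⟩
  obtain ⟨x, hx⟩ := hLne
  have hxz := hadjL x hx
  have hx' := (hmemL x).1 hx
  by_cases h1 : ∀ u ∈ L, u = x
  · obtain ⟨us, hus⟩ := ih (U \ {x, z})
      (Finset.ssubset_iff_subset_ne.2 ⟨Finset.sdiff_subset, by
        intro h; rw [← h] at hz; simp at hz⟩) (by grind) (by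
        intro v hv
        obtain ⟨u, hu⟩ := hne v (by grind)
        exact ⟨u, by grind⟩)
    refine ⟨_, hus.cons (.single s(x, z)) ?_ ?_ ?_ ?_ ?_⟩
    · simpa [edges] using hxz
    · simp [edges, hx'.1, hz]
    · simp [edges]
    · simp [edges]
    · intro v
      simp only [effect, incidence, Sym2.mem_iff, mem_insert, mem_singleton]
      grind
  push Not at h1
  obtain ⟨y, hy, hyx⟩ := h1
  have hyz := hadjL y hy
  have hy' := (hmemL y).1 hy
  by_cases h2 : ∀ u ∈ L, u = x ∨ u = y
  · obtain ⟨us, hus⟩ := ih (U \ {x, y, z})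
      (Finset.ssubset_iff_subset_ne.2 ⟨Finset.sdiff_subset, by
        intro h; rw [← h] at hz; simp at hz⟩) (by grind) (by
        intro v hv
        obtain ⟨u, hu⟩ := hne v (by grind)
        exact ⟨u, by grind⟩)
    refine ⟨_, hus.cons (.parallel s(x, z) s(y, z)) ?_ ?_ ?_ ?_ ?_⟩
    · simpa [edges] using ⟨hxz, hyz⟩
    · simp [edges, hx'.1, hz, hy'.1]
    · simp [edges, hyx.symm, hx'.2.1]
    · simp [edges]
    · intro v
      simp only [effect, incidence, Sym2.mem_iff, mem_insert, mem_singleton]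
      grind
  push Not at h2
  obtain ⟨w, hw, hwx, hwy⟩ := h2
  have hw' := (hmemL w).1 hw
  obtain ⟨us, hus⟩ := ih (U \ {x, y})
    (Finset.ssubset_iff_subset_ne.2 ⟨Finset.sdiff_subset, by
      intro h; have := hx'.1; rw [← h] at this; simp at this⟩) (by grind) (by
      intro v hv
      by_cases hvz : c v = z
      · by_cases hvz' : v = z
        · exact ⟨w, by grind⟩
        · exact ⟨z, by grind⟩
      · obtain ⟨u, hu⟩ := hne v (by grind)
        exact ⟨u, by grind⟩)
  refine ⟨_, hus.cons (.opposite s(x, z) s(y, z)) ?_ ?_ ?_ ?_ ?_⟩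
  · simpa [edges] using ⟨hxz, hyz⟩
  · simp [edges, hx'.1, hz, hy'.1]
  · simp [edges, hyx.symm, hx'.2.1]
  · simp [edges]
  · intro v
    simp only [effect, incidence, Sym2.mem_iff, mem_insert, mem_singleton]
    grind

end LabelGadget

end Gadgets

/-! ### Grouping gadgets into rows of four signed edges -/

section Rows

variable {V : Type*} [DecidableEq V]

/-- The directions in which the four labels of a row are moved. -/
def rowSign : Fin 4 → ℤ := ![1, 1, -1, -1]

/-- The rate at which the sum at `v` changes when the labels of the row `r` are moved. -/
def rowEffect (r : Fin 4 → Sym2 V) (v : V) : ℤ := ∑ j, rowSign j * incidence v (r j)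

theorem rowEffect_cons (e₀ e₁ e₂ e₃ : Sym2 V) (v : V) :
    rowEffect ![e₀, e₁, e₂, e₃] v =
      incidence v e₀ + incidence v e₁ - incidence v e₂ - incidence v e₃ := by
  simp [rowEffect, Fin.sum_univ_four, rowSign]; ring

theorem exists_mem_of_rowEffect_ne_zero {r : Fin 4 → Sym2 V} {v : V} (h : rowEffect r v ≠ 0) :
    ∃ j, v ∈ r j := by
  by_contra hcon
  push Not at hcon
  exact h (Finset.sum_eq_zero fun j _ => by simp [incidence, hcon j])

namespace LabelGadget

/-- The row `r` consists of the edges of the gadgets `gs` and affects the same vertices. -/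
structure IsRow (r : Fin 4 → Sym2 V) (gs : List (LabelGadget V)) : Prop where
  perm : (List.ofFn r).Perm (gs.flatMap edges)
  effect_iff : gs.Pairwise Independent →
    ∀ v, rowEffect r v ≠ 0 ↔ ∃ a ∈ gs, a.effect v ≠ 0

theorem isRow_single (e₀ e₁ e₂ e₃ : Sym2 V) :
    IsRow ![e₀, e₁, e₂, e₃] [.single e₀, .single e₁, .single e₂, .single e₃] where
  perm := by simp [edges, List.ofFn_succ]
  effect_iff := by
    intro h v
    simp only [List.pairwise_cons, List.mem_cons, Independent, List.not_mem_nil, or_false,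
      forall_eq_or_imp, forall_eq, exists_eq_or_imp, exists_eq_left] at h ⊢
    rw [rowEffect_cons]
    obtain ⟨⟨h1, h2, h3⟩, ⟨h4, h5⟩, h6, -⟩ := h
    have h1 := h1 v; have h2 := h2 v; have h3 := h3 v; have h4 := h4 v; have h5 := h5 v
    have h6 := h6 v
    simp only [effect] at *
    omega

/-- Each gadget occupies one positive and one negative slot, so the row signs reproduce its own
effect, and independence prevents cancellation between the two. -/
theorem isRow_opposite (e₀ e₁ e₂ e₃ : Sym2 V) :
    IsRow ![e₀, e₁, e₂, e₃] [.opposite e₀ e₂, .opposite e₁ e₃] where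
  perm := by
    simp only [edges, List.ofFn_succ, List.flatMap_cons, List.flatMap_nil]
    exact List.Perm.cons _ (List.Perm.swap _ _ _)
  effect_iff := by
    intro h v
    simp only [List.pairwise_cons, List.mem_cons, Independent, List.not_mem_nil, or_false,
      forall_eq, exists_eq_or_imp, exists_eq_left] at h ⊢
    rw [rowEffect_cons]
    have h1 := h.1 v
    simp only [effect] at *
    omega

theorem isRow_parallel (e₀ e₁ e₂ e₃ : Sym2 V) :
    IsRow ![e₀, e₁, e₂, e₃] [.parallel e₀ e₁, .parallel e₂ e₃] where
  perm := by simp [edges, List.ofFn_succ]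
  effect_iff := by
    intro h v
    simp only [List.pairwise_cons, List.mem_cons, Independent, List.not_mem_nil, or_false,
      forall_eq, exists_eq_or_imp, exists_eq_left] at h ⊢
    rw [rowEffect_cons]
    have h1 := h.1 v
    simp only [effect] at *
    omega

/-- All but at most five gadgets can be grouped into rows. -/
theorem exists_rows (us : List (LabelGadget V)) :
    ∃ (P : List ((Fin 4 → Sym2 V) × List (LabelGadget V))) (S : List (Sym2 V))
      (Q R : List (Sym2 V × Sym2 V)),
      us.Perm (P.flatMap (fun p => p.2) ++ (S.map .single ++ (Q.map (fun q => .opposite q.1 q.2) ++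
        R.map (fun q => .parallel q.1 q.2)))) ∧
      (∀ p ∈ P, IsRow p.1 p.2) ∧ S.length ≤ 3 ∧ Q.length ≤ 1 ∧ R.length ≤ 1 := by
  classical
  induction us with
  | nil => exact ⟨[], [], [], [], by simp⟩
  | cons a us ih =>
    obtain ⟨P, S, Q, R, hperm, hP, hS, hQ, hR⟩ := ih
    rw [List.perm_iff_count] at hperm
    cases a with
    | single e =>
      by_cases h : S.length ≤ 2
      · refine ⟨P, e :: S, Q, R, ?_, hP, by simp only [List.length_cons]; omega, hQ, hR⟩
        rw [List.perm_iff_count]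
        intro b
        have := hperm b
        simp only [List.count_cons, List.count_append, List.map_cons] at this ⊢
        omega
      · obtain ⟨x, y, z, rfl⟩ := List.length_eq_three.1 (show S.length = 3 by omega)
        refine ⟨(![e, x, y, z], [.single e, .single x, .single y, .single z]) :: P, [], Q, R,
          ?_, ?_, by simp, hQ, hR⟩
        · rw [List.perm_iff_count]
          intro b
          have := hperm b
          simp only [List.count_cons, List.count_append, List.map_cons, List.flatMap_cons,
            List.map_nil, List.count_nil] at this ⊢
          omega
        · exact List.forall_mem_cons.2 ⟨isRow_single e x y z, hP⟩
    | opposite e e' =>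
      by_cases h : Q.length ≤ 0
      · refine ⟨P, S, (e, e') :: Q, R, ?_, hP, hS, by simpa using h, hR⟩
        rw [List.perm_iff_count]
        intro b
        have := hperm b
        simp only [List.count_cons, List.count_append, List.map_cons] at this ⊢
        omega
      · obtain ⟨⟨x, y⟩, rfl⟩ := List.length_eq_one_iff.1 (show Q.length = 1 by omega)
        refine ⟨(![e, x, e', y], [.opposite e e', .opposite x y]) :: P, S, [], R,
          ?_, ?_, hS, by simp, hR⟩
        · rw [List.perm_iff_count]
          intro b
          have := hperm b
          simp only [List.count_cons, List.count_append, List.map_cons, List.flatMap_cons,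
            List.map_nil, List.count_nil] at this ⊢
          omega
        · exact List.forall_mem_cons.2 ⟨isRow_opposite e x e' y, hP⟩
    | parallel e e' =>
      by_cases h : R.length ≤ 0
      · refine ⟨P, S, Q, (e, e') :: R, ?_, hP, hS, hQ, by simpa using h⟩
        rw [List.perm_iff_count]
        intro b
        have := hperm b
        simp only [List.count_cons, List.count_append, List.map_cons] at this ⊢
        omega
      · obtain ⟨⟨x, y⟩, rfl⟩ := List.length_eq_one_iff.1 (show R.length = 1 by omega)
        refine ⟨(![e, e', x, y], [.parallel e e', .parallel x y]) :: P, S, Q, [],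
          ?_, ?_, hS, hQ, by simp⟩
        · rw [List.perm_iff_count]
          intro b
          have := hperm b
          simp only [List.count_cons, List.count_append, List.map_cons, List.flatMap_cons,
            List.map_nil, List.count_nil] at this ⊢
          omega
        · exact List.forall_mem_cons.2 ⟨isRow_parallel e e' x y, hP⟩

theorem length_flatMap_edges_le {W : Type*} (l : List (LabelGadget W)) :
    (l.flatMap edges).length ≤ 2 * l.length := by
  induction l with
  | nil => simp
  | cons a l ih =>
    have ha : a.edges.length ≤ 2 := by cases a <;> simp [edges]
    simp only [List.flatMap_cons, List.length_append, List.length_cons]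
    omega

end LabelGadget

theorem card_biUnion_sym2_toFinset_le (l : List (Sym2 V)) :
    #(l.toFinset.biUnion Sym2.toFinset) ≤ 2 * l.length := by
  refine Finset.card_biUnion_le.trans ?_
  refine (Finset.sum_le_card_nsmul _ _ 2 fun e _ => ?_).trans ?_
  · rw [Sym2.card_toFinset]; split_ifs <;> omega
  · have := l.toFinset_card_le
    simp only [smul_eq_mul]; omega

/-- In a graph without isolated vertices there are disjoint rows of four edges such that each
vertex is affected by at most one row, and all but at most twenty vertices are affected. -/
theorem exists_rowSystem [Fintype V] (H : SimpleGraph V) (hH : ∀ v, ∃ u, H.Adj v u) :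
    ∃ (N : ℕ) (ε : Fin N → Fin 4 → Sym2 V), (∀ i j, ε i j ∈ H.edgeSet) ∧
      (∀ i j i' j', ε i j = ε i' j' → i = i' ∧ j = j') ∧
      (∀ v i i', rowEffect (ε i) v ≠ 0 → rowEffect (ε i') v ≠ 0 → i = i') ∧
      #{v | ∀ i, rowEffect (ε i) v = 0} ≤ 20 := by
  classical
  obtain ⟨c, hc, hadj, hne⟩ := exists_spanning_starForest H hH
  obtain ⟨us, hus⟩ := LabelGadget.exists_isCover_of_starForest hc hadj Finset.univ (by simp)
    (by simpa using hne)
  obtain ⟨P, S, Q, R, hperm, hP, hS, hQ, hR⟩ := LabelGadget.exists_rows us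
  set left : List (LabelGadget V) := S.map .single ++ (Q.map (fun q => .opposite q.1 q.2) ++
        R.map (fun q => .parallel q.1 q.2)) with hleft
  have hpw := (hperm.pairwise_iff (fun h => LabelGadget.Independent.symm h)).1 hus.pairwise
  rw [List.pairwise_append] at hpw
  obtain ⟨hpw, -, -⟩ := hpw
  rw [List.pairwise_flatMap] at hpw
  have hnd : ((P.flatMap fun p => p.2).flatMap LabelGadget.edges).Nodup := by
    have := (hperm.flatMap_right LabelGadget.edges).nodup_iff.1 hus.nodup
    rw [List.flatMap_append] at this
    exact (List.nodup_append.1 this).1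
  rw [List.flatMap_assoc] at hnd
  have hnd' : (P.flatMap fun p => List.ofFn p.1).Nodup := by
    refine (List.Perm.nodup_iff ?_).1 hnd
    exact List.Perm.flatMap_left _ fun p hp => ((hP p hp).perm).symm
  rw [List.nodup_flatMap] at hnd'
  obtain ⟨hndrow, hnddisj⟩ := hnd'
  refine ⟨P.length, fun i => (P.get i).1, ?_, ?_, ?_, ?_⟩
  · intro i j
    have h1 : (P.get i).1 j ∈ (P.get i).2.flatMap LabelGadget.edges :=
      (hP _ (List.get_mem P i)).perm.subset (List.mem_ofFn.2 ⟨j, rfl⟩)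
    obtain ⟨a, ha, hae⟩ := List.mem_flatMap.1 h1
    refine hus.mem_edgeSet a (hperm.symm.subset ?_) _ hae
    exact List.mem_append_left _ (List.mem_flatMap.2 ⟨_, List.get_mem P i, ha⟩)
  · intro i j i' j' h
    have hii : i = i' := by
      by_contra hne
      rcases lt_or_gt_of_ne hne with hlt | hlt
      · exact (List.pairwise_iff_get.1 hnddisj i i' hlt) (List.mem_ofFn.2 ⟨j, rfl⟩)
          (List.mem_ofFn.2 ⟨j', h.symm⟩)
      · exact (List.pairwise_iff_get.1 hnddisj i' i hlt) (List.mem_ofFn.2 ⟨j', rfl⟩)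
          (List.mem_ofFn.2 ⟨j, h⟩)
    subst hii
    exact ⟨rfl, List.nodup_ofFn.1 (hndrow _ (List.get_mem P i)) h⟩
  · intro v i i' h h'
    obtain ⟨a, ha, hav⟩ := ((hP _ (List.get_mem P i)).effect_iff
      (hpw.1 _ (List.get_mem P i)) v).1 h
    obtain ⟨b, hb, hbv⟩ := ((hP _ (List.get_mem P i')).effect_iff
      (hpw.1 _ (List.get_mem P i')) v).1 h'
    by_contra hne
    rcases lt_or_gt_of_ne hne with hlt | hlt
    · rcases List.pairwise_iff_get.1 hpw.2 i i' hlt a ha b hb v with h0 | h0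
      exacts [hav h0, hbv h0]
    · rcases List.pairwise_iff_get.1 hpw.2 i' i hlt b hb a ha v with h0 | h0
      exacts [hbv h0, hav h0]
  · have hsub : (univ.filter fun v => ∀ i, rowEffect ((P.get i).1) v = 0) ⊆
        (left.flatMap LabelGadget.edges).toFinset.biUnion Sym2.toFinset := by
      intro v hv
      simp only [mem_filter, mem_univ, true_and] at hv
      obtain ⟨a, ha, hav⟩ := hus.cover v (mem_univ v)
      rcases List.mem_append.1 (hperm.subset ha) with h | h
      · obtain ⟨p, hp, hap⟩ := List.mem_flatMap.1 h
        obtain ⟨i, rfl⟩ := List.get_of_mem hp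
        exact absurd (hv i) (((hP _ hp).effect_iff (hpw.1 _ hp) v).2 ⟨a, hap, hav⟩)
      · obtain ⟨e, he, hve⟩ := LabelGadget.exists_mem_of_effect_ne_zero hav
        refine Finset.mem_biUnion.2 ⟨e, ?_, Sym2.mem_toFinset.2 hve⟩
        exact List.mem_toFinset.2 (List.mem_flatMap.2 ⟨a, h, he⟩)
    refine (Finset.card_le_card hsub).trans ((card_biUnion_sym2_toFinset_le _).trans ?_)
    -- Five leftover gadgets have at most two edges each, and each edge two ends: twenty vertices.
    have hlen : left.length ≤ 5 := by
      simp only [hleft, List.length_append, List.length_map]; omega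
    have := LabelGadget.length_flatMap_edges_le left
    omega

end Rows

/-- In a graph of minimum degree at least six, every vertex can be given three incident edges
not given to any other vertex. -/
theorem SimpleGraph.exists_injective_incident {V : Type*} [Fintype V] [DecidableEq V]
    (G : SimpleGraph V) [DecidableRel G.Adj] (hG : ∀ v, 6 ≤ G.degree v) :
    ∃ e : V × Fin 3 → Sym2 V, Function.Injective e ∧ ∀ p, e p ∈ G.incidenceFinset p.1 := by
  classical
  refine (Finset.all_card_le_biUnion_card_iff_exists_injective
    fun p : V × Fin 3 => G.incidenceFinset p.1).1 fun s => ?_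
  have h1 : #s ≤ 3 * #(s.image Prod.fst) := by
    have hsub : s ⊆ s.image Prod.fst ×ˢ (univ : Finset (Fin 3)) := fun p hp => by
      simpa using ⟨p.2, hp⟩
    have := Finset.card_le_card hsub
    rw [Finset.card_product, Finset.card_fin] at this
    omega
  -- Hall's condition by double counting: each vertex sees at least six edges and each edge at most
  -- two vertices, so there are three edges per vertex.
  have h2 : #(s.image Prod.fst) * 6 ≤ #(s.biUnion fun p => G.incidenceFinset p.1) * 2 := by
    refine Finset.card_mul_le_card_mul (fun v e => v ∈ e) ?_ ?_
    · intro v hv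
      obtain ⟨p, hp, rfl⟩ := Finset.mem_image.1 hv
      refine (hG p.1).trans ?_
      rw [← G.card_incidenceFinset_eq_degree]
      refine Finset.card_le_card fun e he => ?_
      rw [Finset.mem_bipartiteAbove]
      refine ⟨Finset.mem_biUnion.2 ⟨p, hp, he⟩, ?_⟩
      rw [SimpleGraph.mem_incidenceFinset] at he
      exact he.2
    · intro e _
      have : (s.image Prod.fst).bipartiteBelow (fun v e => v ∈ e) e ⊆ e.toFinset := fun v hv =>
        Sym2.mem_toFinset.2 ((Finset.mem_bipartiteBelow _).1 hv).2
      refine (Finset.card_le_card this).trans ?_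
      rw [Sym2.card_toFinset]; split_ifs <;> omega
  omega

/-! ### Choosing the columns: separating all vertex sums -/

section Separation

variable {V : Type*} [Fintype V] [DecidableEq V]

/-- Moving the rows by a suitable permutation makes all the values `W v + k * σ v * π (ρ v)`
different, provided that the values `W v` have few coincidences modulo `k`. -/
theorem exists_perm_injective {N : ℕ} (hN : 2 ≤ N) (k : ℤ) (hk : k ≠ 0) (ρ : V → Fin N)
    (σ W : V → ℤ) (q A B c K : ℕ)
    (hfib : ∀ i, #{v | ρ v = i} ≤ q)
    (hstat : ∀ u v, σ u = 0 → σ v = 0 → ρ u = ρ v)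
    (hrow : ∀ u v, u ≠ v → ρ u = ρ v → W u ≠ W v)
    (hA : #{p : V × V | p.1 ≠ p.2 ∧ k ∣ W p.1 - W p.2} ≤ A)
    (hB : #{p : V × V | ρ p.1 = ρ p.2 ∧ p.1 ≠ p.2 ∧ k ∣ W p.1 - W p.2} ≤ B)
    (hc : ∀ u, #{v | u ≠ v ∧ k ∣ W u - W v} ≤ c)
    (hrowK : N * (3 * q * c) ≤ K) (hcolK : 2 * A + N * (2 * q * c + B) ≤ K)
    (hK : 16 * K ≤ N * (N - 1)) :
    ∃ π : Equiv.Perm (Fin N), Function.Injective fun v => W v + k * σ v * (π (ρ v) : ℤ) := by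
  classical
  -- Two vertices of the same row constrain only one cell. To fit the local lemma this is paired
  -- with a dummy cell in the different row `ν (ρ u)` and an arbitrary column.
  obtain ⟨ν, hν⟩ : ∃ ν : Equiv.Perm (Fin N), ∀ i, ν i ≠ i := by
    obtain ⟨n, rfl⟩ : ∃ n, N = n + 2 := ⟨N - 2, by omega⟩
    exact ⟨Equiv.addRight 1, fun i => by simp⟩
  let F : V → Fin N → ℤ := fun v t => W v + k * σ v * (t : ℤ)
  let bad : (V × V) × (Fin N × Fin N) → Prop := fun j => j.1.1 ≠ j.1.2 ∧
    if ρ j.1.1 = ρ j.1.2 then F j.1.1 j.2.1 = F j.1.2 j.2.1 else F j.1.1 j.2.1 = F j.1.2 j.2.2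
  let r₁ : (V × V) × (Fin N × Fin N) → Fin N := fun j => ρ j.1.1
  let r₂ : (V × V) × (Fin N × Fin N) → Fin N := fun j =>
    if ρ j.1.1 = ρ j.1.2 then ν (ρ j.1.1) else ρ j.1.2
  let cong : V × V → Prop := fun p => p.1 ≠ p.2 ∧ k ∣ W p.1 - W p.2
  have hFeq : ∀ u v s t, F u s = F v t → k ∣ W u - W v := by
    intro u v s t h
    refine ⟨σ v * t - σ u * s, ?_⟩
    simp only [F] at h
    linear_combination h
  have hcong : ∀ j, bad j → cong j.1 := by
    rintro j ⟨hne, h⟩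
    refine ⟨hne, ?_⟩
    split_ifs at h
    exacts [hFeq _ _ _ _ h, hFeq _ _ _ _ h]
  have hFinj : ∀ v, σ v ≠ 0 → Function.Injective (F v) := by
    intro v hv s t h
    have h' : k * σ v * ((s : ℕ) : ℤ) = k * σ v * ((t : ℕ) : ℤ) := by simpa [F] using h
    have := mul_left_cancel₀ (mul_ne_zero hk hv) h'
    exact Fin.ext (by exact_mod_cast this)
  have hdet₁ : ∀ p : V × V, (ρ p.1 = ρ p.2 ∨ σ p.1 ≠ 0) → ∀ s s' t, bad (p, s, t) →
      bad (p, s', t) → s = s' := by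
    rintro ⟨u, v⟩ hp s s' t ⟨hne, h1⟩ ⟨-, h2⟩
    by_cases huv : ρ u = ρ v
    · simp only [huv, if_true] at h1 h2
      have h1 : W u - W v = k * (σ v - σ u) * (s : ℕ) := by
        simp only [F] at h1; linear_combination h1
      have h2 : W u - W v = k * (σ v - σ u) * (s' : ℕ) := by
        simp only [F] at h2; linear_combination h2
      have hσ : σ v - σ u ≠ 0 := by
        intro h0
        rw [h0] at h1
        exact hrow u v hne huv (by linarith)
      have := mul_left_cancel₀ (mul_ne_zero hk hσ) (h1.symm.trans h2)
      exact Fin.ext (by exact_mod_cast this)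
    · simp only [huv, if_false] at h1 h2
      exact hFinj u (hp.resolve_left huv) (h1.trans h2.symm)
  have hdet₂ : ∀ p : V × V, ρ p.1 ≠ ρ p.2 → σ p.2 ≠ 0 → ∀ s t t', bad (p, s, t) →
      bad (p, s, t') → t = t' := by
    rintro ⟨u, v⟩ huv hv s t t' ⟨hne, h1⟩ ⟨-, h2⟩
    simp only [if_neg huv] at h1 h2
    exact hFinj v hv (h1.symm.trans h2)
  let E : Finset ((V × V) × (Fin N × Fin N)) := univ.filter bad
  -- For a fixed pair of vertices one column determines the other, or, within a row, the first
  -- column is determined and the dummy is free. In different rows one of the two effects is nonzero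
  -- by `hstat`.
  have hfibre : ∀ p : V × V, #{j ∈ E | j.1 = p} ≤ N := by
    intro p
    by_cases hp : ρ p.1 = ρ p.2 ∨ σ p.1 ≠ 0
    · have := Finset.card_le_card_of_injOn (s := E.filter fun j => j.1 = p)
        (t := (univ : Finset (Fin N))) (fun j => j.2.2) (fun _ _ => by simp) (by
          rintro ⟨p₁, s, t⟩ hj ⟨p₂, s', t'⟩ hj' (rfl : t = t')
          simp only [coe_filter, E, mem_filter, mem_univ, true_and, Set.mem_ofPred_eq] at hj hj'
          obtain ⟨hj, rfl⟩ := hj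
          obtain ⟨hj', rfl⟩ := hj'
          rw [hdet₁ _ hp _ _ _ hj hj'])
      simpa using this
    · push Not at hp
      have := Finset.card_le_card_of_injOn (s := E.filter fun j => j.1 = p)
        (t := (univ : Finset (Fin N))) (fun j => j.2.1) (fun _ _ => by simp) (by
          rintro ⟨p₁, s, t⟩ hj ⟨p₂, s', t'⟩ hj' (rfl : s = s')
          simp only [coe_filter, E, mem_filter, mem_univ, true_and, Set.mem_ofPred_eq] at hj hj'
          obtain ⟨hj, rfl⟩ := hj
          obtain ⟨hj', rfl⟩ := hj'
          rw [hdet₂ _ hp.1 (fun h => hp.1 (hstat _ _ hp.2 h)) _ _ _ hj hj'])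
      simpa using this
  have hpair₁ : ∀ S : Finset V, #{p : V × V | cong p ∧ p.1 ∈ S} ≤ #S * c := by
    intro S
    rw [mul_comm]
    refine Finset.card_le_mul_card_image_of_maps_to (f := Prod.fst)
      (fun p hp => (Finset.mem_filter.1 hp).2.2) c fun u _ => ?_
    refine le_trans ?_ (hc u)
    refine Finset.card_le_card_of_injOn Prod.snd ?_ ?_
    · rintro ⟨a, b⟩ hp
      simp only [coe_filter, mem_filter, mem_univ, true_and, Set.mem_ofPred_eq] at hp ⊢
      obtain ⟨⟨hp, -⟩, rfl⟩ := hp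
      exact hp
    · rintro ⟨a, b⟩ hp ⟨a', b'⟩ hp' h
      simp only [coe_filter, mem_filter, mem_univ, true_and, Set.mem_ofPred_eq] at hp hp'
      exact Prod.ext (hp.2.trans hp'.2.symm) h
  have hpair₂ : ∀ S : Finset V, #{p : V × V | cong p ∧ p.2 ∈ S} ≤ #S * c := by
    intro S
    refine le_trans (Finset.card_le_card_of_injOn Prod.swap ?_
      Prod.swap_injective.injOn) (hpair₁ S)
    rintro ⟨a, b⟩ hp
    simp only [coe_filter, mem_univ, true_and, Set.mem_ofPred_eq, cong, Prod.swap] at hp ⊢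
    exact ⟨⟨hp.1.1.symm, by rw [dvd_sub_comm]; exact hp.1.2⟩, hp.2⟩
  have hcount : ∀ (C : (V × V) × (Fin N × Fin N) → Prop) [DecidablePred C] (Q : Finset (V × V)),
      (∀ j, bad j → C j → j.1 ∈ Q) → #{j ∈ E | C j} ≤ N * #Q := by
    intro C _ Q hQ
    refine Finset.card_le_mul_card_image_of_maps_to (f := Prod.fst) ?_ N fun p _ => ?_
    · intro j hj
      obtain ⟨hjE, hjC⟩ := Finset.mem_filter.1 hj
      exact hQ j (Finset.mem_filter.1 hjE).2 hjC
    · refine le_trans (Finset.card_le_card ?_) (hfibre p)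
      exact Finset.filter_subset_filter _ (Finset.filter_subset _ _)
  have hstatc : #{v | σ v = 0} ≤ q := by
    rcases (univ.filter fun v => σ v = 0).eq_empty_or_nonempty with h | ⟨v, hv⟩
    · simp [h]
    · refine le_trans (Finset.card_le_card ?_) (hfib (ρ v))
      intro u hu
      simp only [mem_filter, mem_univ, true_and] at hu hv ⊢
      exact hstat u v hu hv
  have hrowE : ∀ i, #{j ∈ E | r₁ j = i ∨ r₂ j = i} ≤ K := by
    intro i
    refine le_trans (hcount _ (((univ.filter fun p => cong p ∧ p.1 ∈ univ.filter fun v => ρ v = i) ∪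
      (univ.filter fun p => cong p ∧ p.1 ∈ univ.filter fun v => ρ v = ν.symm i)) ∪
      (univ.filter fun p => cong p ∧ p.2 ∈ univ.filter fun v => ρ v = i)) ?_)
      (le_trans (Nat.mul_le_mul_left N ?_) hrowK)
    · intro j hj hr
      have := hcong j hj
      simp only [mem_union, mem_filter, mem_univ, true_and, this]
      rcases hr with hr | hr
      · exact Or.inl (Or.inl hr)
      · simp only [r₂] at hr
        split_ifs at hr
        · exact Or.inl (Or.inr (by rw [← hr]; simp))
        · exact Or.inr hr
    · refine (Finset.card_union_le _ _).trans ((Nat.add_le_add_right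
        (Finset.card_union_le _ _) _).trans ?_)
      have h1 := (hpair₁ _).trans (Nat.mul_le_mul_right c (hfib i))
      have h2 := (hpair₁ _).trans (Nat.mul_le_mul_right c (hfib (ν.symm i)))
      have h3 := (hpair₂ _).trans (Nat.mul_le_mul_right c (hfib i))
      calc _ ≤ q * c + q * c + q * c := Nat.add_le_add (Nat.add_le_add h1 h2) h3
        _ = 3 * q * c := by ring
  have hcolE : ∀ s, #{j ∈ E | j.2.1 = s ∨ j.2.2 = s} ≤ K := by
    intro s
    -- For a generic pair either column determines the other, so column `s` meets at most two of its
    -- events. For a special pair all `N` events are counted, which is affordable because special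
    -- congruent pairs are few.
    let special : V × V → Prop := fun p => ρ p.1 = ρ p.2 ∨ σ p.1 = 0 ∨ σ p.2 = 0
    refine le_trans ?_ hcolK
    rw [← Finset.card_filter_add_card_filter_not
      (s := E.filter fun j => j.2.1 = s ∨ j.2.2 = s) (fun j => ¬ special j.1)]
    refine Nat.add_le_add ?_ ?_
    · refine le_trans ?_ (Nat.mul_le_mul_left 2 hA)
      refine Finset.card_le_mul_card_image_of_maps_to (f := Prod.fst) ?_ 2 fun p _ => ?_
      · intro j hj
        simp only [mem_filter, E, mem_univ, true_and] at hj ⊢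
        exact hcong j hj.1.1
      · by_cases hp : special p
        · rw [Finset.card_eq_zero.2]
          · omega
          · rw [Finset.filter_eq_empty_iff]
            rintro j hj rfl
            exact (Finset.mem_filter.1 hj).2 hp
        · simp only [special] at hp
          push Not at hp
          refine le_trans (Finset.card_le_card (t := (E.filter fun j => j.1 = p ∧ j.2.1 = s) ∪
            (E.filter fun j => j.1 = p ∧ j.2.2 = s)) ?_) ((Finset.card_union_le _ _).trans ?_)
          · intro j hj
            simp only [mem_filter, mem_union] at hj ⊢
            tauto
          · refine Nat.add_le_add (b := 1) (d := 1) (Finset.card_le_one.2 ?_)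
              (Finset.card_le_one.2 ?_)
            · rintro ⟨p₁, a, b⟩ hj ⟨p₂, a', b'⟩ hj'
              simp only [mem_filter, E, mem_univ, true_and] at hj hj'
              obtain ⟨hj, rfl, rfl⟩ := hj
              obtain ⟨hj', rfl, rfl⟩ := hj'
              rw [hdet₂ _ hp.1 hp.2.2 _ _ _ hj hj']
            · rintro ⟨p₁, a, b⟩ hj ⟨p₂, a', b'⟩ hj'
              simp only [mem_filter, E, mem_univ, true_and] at hj hj'
              obtain ⟨hj, rfl, rfl⟩ := hj
              obtain ⟨hj', rfl, rfl⟩ := hj'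
              rw [hdet₁ _ (Or.inr hp.2.1) _ _ _ hj hj']
    · rw [Finset.filter_filter]
      refine le_trans (hcount _ (((univ.filter fun p => cong p ∧ p.1 ∈ univ.filter fun v => σ v = 0) ∪
        (univ.filter fun p => cong p ∧ p.2 ∈ univ.filter fun v => σ v = 0)) ∪
        (univ.filter fun p => ρ p.1 = ρ p.2 ∧ cong p)) ?_) (Nat.mul_le_mul_left N ?_)
      · intro j hj hr
        have := hcong j hj
        simp only [mem_union, mem_filter, mem_univ, true_and, this, and_true]
        have h := not_not.1 hr.2
        simp only [special] at h
        tauto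
      · refine (Finset.card_union_le _ _).trans ((Nat.add_le_add_right
          (Finset.card_union_le _ _) _).trans ?_)
        have h1 := (hpair₁ _).trans (Nat.mul_le_mul_right c hstatc)
        have h2 := (hpair₂ _).trans (Nat.mul_le_mul_right c hstatc)
        calc _ ≤ q * c + q * c + B := Nat.add_le_add (Nat.add_le_add h1 h2) hB
          _ = 2 * q * c + B := by ring
  obtain ⟨π, hπ⟩ := exists_perm_avoiding r₁ r₂ (fun j => j.2.1) (fun j => j.2.2) E (by
      intro j _
      simp only [r₁, r₂]
      split_ifs with h
      exacts [(hν _).symm, h]) K hrowE hcolE (by simpa using hK)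
  refine ⟨π, fun u v huv => ?_⟩
  by_contra hne
  by_cases hρ : ρ u = ρ v
  · refine hπ ((u, v), π (ρ u), π (ν (ρ u))) ?_ ⟨rfl, by simp [r₂, hρ]⟩
    simp only [E, bad, mem_filter, mem_univ, true_and]
    refine ⟨hne, ?_⟩
    rw [if_pos hρ]
    simp only [F]
    simpa [hρ] using huv
  · refine hπ ((u, v), π (ρ u), π (ρ v)) ?_ ⟨rfl, by simp [r₂, hρ]⟩
    simp only [E, bad, mem_filter, mem_univ, true_and]
    refine ⟨hne, ?_⟩
    rw [if_neg hρ]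
    exact huv

end Separation

/-- A double-counting form of Markov's inequality. -/
theorem card_filter_lt_card_filter_le {Ω β : Type*} [Fintype Ω] (P : Finset β)
    (ev : β → Ω → Prop) [∀ p, DecidablePred (ev p)] (k b : ℕ) (hP : #P ≤ b)
    (hev : ∀ p ∈ P, k * #{τ | ev p τ} ≤ 4 * Fintype.card Ω) :
    4 * #{τ | 16 * b < k * #{p ∈ P | ev p τ}} ≤ Fintype.card Ω := by
  rcases Nat.eq_zero_or_pos b with rfl | hb
  · have : P = ∅ := by simpa using hP
    simp [this]
  have h1 : #{τ | 16 * b < k * #{p ∈ P | ev p τ}} * (16 * b) ≤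
      ∑ τ, k * #{p ∈ P | ev p τ} := by
    calc _ ≤ ∑ τ with 16 * b < k * #{p ∈ P | ev p τ}, k * #{p ∈ P | ev p τ} := by
          rw [← smul_eq_mul]
          exact Finset.card_nsmul_le_sum _ _ _ fun τ hτ => (Finset.mem_filter.1 hτ).2.le
      _ ≤ _ := Finset.sum_le_sum_of_subset (Finset.subset_univ _)
  have h2 : ∑ τ, k * #{p ∈ P | ev p τ} = ∑ p ∈ P, k * #{τ | ev p τ} := by
    simp only [← Finset.mul_sum, Finset.card_filter]
    rw [Finset.sum_comm]
  have h3 : ∑ p ∈ P, k * #{τ | ev p τ} ≤ b * (4 * Fintype.card Ω) := by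
    refine (Finset.sum_le_card_nsmul P _ _ hev).trans ?_
    rw [smul_eq_mul]
    exact Nat.mul_le_mul_right _ hP
  have h4 := h1.trans (h2.le.trans h3)
  refine Nat.le_of_mul_le_mul_left ?_ (show 0 < 4 * b by omega)
  linarith

/-! ### Random labels with few coincidences modulo `k` -/

section FewCoincidences

variable {V α : Type*} [Fintype V] [DecidableEq V] [Fintype α] [DecidableEq α]

/-- Some arrangement of the labels `g` gives vertex sums with few coincidences modulo `k`, and no
coincidences within a row. -/
theorem exists_perm_few_coincidences {R : Type*} [DecidableEq R] (g : α → ℤ)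
    (hg : Function.Injective g) (m k q : ℕ) (hgm : ∀ b, 1 ≤ g b ∧ g b ≤ m)
    (hkm : k ≤ m) (I : V → α → ℤ) (κ : V → ℤ) (ρ : V → R)
    (hfib : ∀ v, #{u | ρ u = ρ v} ≤ q)
    (hI : ∀ u v, u ≠ v → ∃ a, I u a - I v a = 1)
    (hI' : ∀ u v, m ≤ 2 * #{b | I u b - I v b = 0})
    (hm : 16 * (q * Fintype.card V) < m) :
    ∃ τ : Equiv.Perm α, ∃ W : V → ℤ, (∀ v, W v = κ v + ∑ e, I v e * g (τ e)) ∧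
      k * #{p : V × V | p.1 ≠ p.2 ∧ (k : ℤ) ∣ W p.1 - W p.2} ≤ 16 * Fintype.card V ^ 2 ∧
      k * #{p : V × V | ρ p.1 = ρ p.2 ∧ p.1 ≠ p.2 ∧ (k : ℤ) ∣ W p.1 - W p.2} ≤
        16 * (q * Fintype.card V) ∧
      ∀ u v, u ≠ v → ρ u = ρ v → W u ≠ W v := by
  classical
  let W : Equiv.Perm α → V → ℤ := fun τ v => κ v + ∑ e, I v e * g (τ e)
  have hdiff : ∀ τ u v, W τ u - W τ v = (κ u - κ v) + ∑ e, (I u e - I v e) * g (τ e) := by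
    intro τ u v
    simp only [W, sub_mul, Finset.sum_sub_distrib]
    ring
  set F := Fintype.card (Equiv.Perm α) with hF
  have hFpos : 0 < F := Fintype.card_pos
  -- At least `m / 2` coefficients vanish and at most `m / k + 1 ≤ 2 * m / k` labels lie in the
  -- required class, so the probability is at most `4 / k`.
  have hcong : ∀ u v, u ≠ v → k * #{τ | (k : ℤ) ∣ W τ u - W τ v} ≤ 4 * F := by
    intro u v huv
    obtain ⟨a, ha⟩ := hI u v huv
    have h := card_perm_filter_mul_le (fun e => I u e - I v e) g
      (fun x => (k : ℤ) ∣ (κ u - κ v) + x) ha (m / k + 1) (fun c => by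
        simpa only [← add_assoc] using card_filter_dvd_add_le g hg m k hgm ((κ u - κ v) + c))
    simp only [← hdiff] at h
    rw [← hF] at h
    have h' := hI' u v
    have hmk : k * (m / k + 1) ≤ 2 * m := by
      have := Nat.mul_div_le m k
      rw [mul_add]; omega
    refine Nat.le_of_mul_le_mul_left ?_ (show 0 < m by omega)
    calc m * (k * #{τ | (k : ℤ) ∣ W τ u - W τ v})
        ≤ (2 * #{b | I u b - I v b = 0}) * (k * #{τ | (k : ℤ) ∣ W τ u - W τ v}) :=
          Nat.mul_le_mul_right _ h'
      _ = 2 * k * (#{τ | (k : ℤ) ∣ W τ u - W τ v} * #{b | I u b - I v b = 0}) := by ring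
      _ ≤ 2 * k * (F * (m / k + 1)) := Nat.mul_le_mul_left _ h
      _ = 2 * F * (k * (m / k + 1)) := by ring
      _ ≤ 2 * F * (2 * m) := Nat.mul_le_mul_left _ hmk
      _ = m * (4 * F) := by ring
  have heq : ∀ u v, u ≠ v → m * #{τ | W τ u = W τ v} ≤ 4 * F := by
    intro u v huv
    obtain ⟨a, ha⟩ := hI u v huv
    have h := card_perm_filter_mul_le (fun e => I u e - I v e) g
      (fun x => (κ u - κ v) + x = 0) ha 1 (fun c => by
        rw [Finset.card_le_one]
        intro b hb b' hb'
        simp only [mem_filter, mem_univ, true_and] at hb hb'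
        exact hg (by linarith))
    simp only [← hdiff, sub_eq_zero (a := W _ _)] at h
    rw [← hF, mul_one] at h
    have h' := hI' u v
    calc m * #{τ | W τ u = W τ v} ≤ (2 * #{b | I u b - I v b = 0}) * #{τ | W τ u = W τ v} :=
          Nat.mul_le_mul_right _ h'
      _ = 2 * (#{τ | W τ u = W τ v} * #{b | I u b - I v b = 0}) := by ring
      _ ≤ 2 * F := Nat.mul_le_mul_left _ h
      _ ≤ 4 * F := by omega
  let P₁ : Finset (V × V) := univ.filter fun p => p.1 ≠ p.2
  let P₂ : Finset (V × V) := univ.filter fun p => ρ p.1 = ρ p.2 ∧ p.1 ≠ p.2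
  have hP₁ : #P₁ ≤ Fintype.card V ^ 2 := by
    refine (Finset.card_le_univ _).trans ?_
    rw [Fintype.card_prod, sq]
  have hP₂ : #P₂ ≤ q * Fintype.card V := by
    refine Finset.card_le_mul_card_image_of_maps_to (f := Prod.fst) (t := univ)
      (fun _ _ => mem_univ _) q fun v _ => ?_
    refine le_trans (Finset.card_le_card_of_injOn Prod.snd ?_ ?_) (hfib v)
    · rintro ⟨a, b⟩ hp
      simp only [P₂, coe_filter, mem_filter, mem_univ, true_and, Set.mem_ofPred_eq] at hp ⊢
      obtain ⟨⟨hp, -⟩, rfl⟩ := hp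
      exact hp.symm
    · rintro ⟨a, b⟩ hp ⟨a', b'⟩ hp' h
      simp only [coe_filter, Set.mem_ofPred_eq] at hp hp'
      exact Prod.ext (hp.2.trans hp'.2.symm) h
  have h1 := card_filter_lt_card_filter_le P₁
    (fun p (τ : Equiv.Perm α) => (k : ℤ) ∣ W τ p.1 - W τ p.2) k _ hP₁
    (fun p hp => hcong p.1 p.2 (Finset.mem_filter.1 hp).2)
  have h2 := card_filter_lt_card_filter_le P₂
    (fun p (τ : Equiv.Perm α) => (k : ℤ) ∣ W τ p.1 - W τ p.2) k _ hP₂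
    (fun p hp => hcong p.1 p.2 (Finset.mem_filter.1 hp).2.2)
  have h3 := card_filter_lt_card_filter_le P₂
    (fun p (τ : Equiv.Perm α) => W τ p.1 = W τ p.2) m _ hP₂
    (fun p hp => heq p.1 p.2 (Finset.mem_filter.1 hp).2.2)
  rw [← hF] at h1 h2 h3
  -- Each of the three conditions fails with probability at most `1 / 4`.
  obtain ⟨τ, hτ₁, hτ₂, hτ₃⟩ : ∃ τ : Equiv.Perm α,
      k * #{p ∈ P₁ | (k : ℤ) ∣ W τ p.1 - W τ p.2} ≤ 16 * Fintype.card V ^ 2 ∧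
      k * #{p ∈ P₂ | (k : ℤ) ∣ W τ p.1 - W τ p.2} ≤ 16 * (q * Fintype.card V) ∧
      m * #{p ∈ P₂ | W τ p.1 = W τ p.2} ≤ 16 * (q * Fintype.card V) := by
    by_contra hcon
    push Not at hcon
    have hcov : (univ : Finset (Equiv.Perm α)) ⊆
        ((univ.filter fun τ => 16 * Fintype.card V ^ 2 <
            k * #{p ∈ P₁ | (k : ℤ) ∣ W τ p.1 - W τ p.2}) ∪
          (univ.filter fun τ => 16 * (q * Fintype.card V) <
            k * #{p ∈ P₂ | (k : ℤ) ∣ W τ p.1 - W τ p.2})) ∪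
          (univ.filter fun τ => 16 * (q * Fintype.card V) <
            m * #{p ∈ P₂ | W τ p.1 = W τ p.2}) := by
      intro τ _
      simp only [mem_union, mem_filter, mem_univ, true_and]
      have := hcon τ
      by_contra h
      push Not at h
      exact absurd (this h.1.1 h.1.2) (by omega)
    have hle := (Finset.card_le_card hcov).trans ((Finset.card_union_le _ _).trans
      (Nat.add_le_add_right (Finset.card_union_le _ _) _))
    rw [Finset.card_univ, ← hF] at hle
    omega
  refine ⟨τ, W τ, fun v => rfl, ?_, ?_, ?_⟩
  · simpa only [P₁, Finset.filter_filter] using hτ₁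
  · simpa only [P₂, Finset.filter_filter, and_assoc] using hτ₂
  · intro u v huv hρ h
    -- The bound `16 * (q * n) < m`, with `n` the number of vertices, forces the number of
    -- equalities within rows below one.
    have : 1 ≤ #{p ∈ P₂ | W τ p.1 = W τ p.2} :=
      Finset.card_pos.2 ⟨(u, v), by simp [P₂, huv, hρ, h]⟩
    have := Nat.mul_le_mul_left m this
    omega

/-- Coincidences with a fixed vertex are controlled by the number of all coincidences. -/
theorem sq_card_coincidences_le (k : ℤ) (W : V → ℤ) (u : V) :
    #{v | u ≠ v ∧ k ∣ W u - W v} ^ 2 ≤ #{p : V × V | p.1 ≠ p.2 ∧ k ∣ W p.1 - W p.2} := by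
  set S : Finset V := univ.filter fun v => u ≠ v ∧ k ∣ W u - W v with hS
  have hu : u ∉ S := by simp [hS]
  -- Congruence is transitive, so `u` and the vertices congruent to it form a clique of
  -- coincidences.
  have hsub : (insert u S).offDiag ⊆ univ.filter fun p : V × V =>
      p.1 ≠ p.2 ∧ k ∣ W p.1 - W p.2 := by
    rintro ⟨a, b⟩ hab
    simp only [mem_offDiag, mem_insert, hS, mem_filter, mem_univ, true_and] at hab ⊢
    have key : ∀ x, (x = u ∨ u ≠ x ∧ k ∣ W u - W x) → k ∣ W u - W x := by
      rintro x (rfl | h)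
      exacts [by simp, h.2]
    refine ⟨hab.2.2, ?_⟩
    have := dvd_sub (key b hab.2.1) (key a hab.1)
    simpa using this
  refine le_trans ?_ (Finset.card_le_card hsub)
  rw [Finset.offDiag_card, Finset.card_insert_of_notMem hu]
  have : (#S + 1) * (#S + 1) - (#S + 1) = #S ^ 2 + #S := by
    have : (#S + 1) * (#S + 1) = #S ^ 2 + #S + (#S + 1) := by ring
    omega
  omega

end FewCoincidences

/-! ### The labels of the movable edges -/

section Labels

/-- The labels of the column `t`, which move with `t` in the directions `rowSign`. -/
def columnLabel (N k : ℕ) (t : Fin N) (j : Fin 4) : ℕ :=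
  k * ![(t : ℕ) + 1, N + t + 1, 3 * N - t, 4 * N - t] j

theorem columnLabel_eq (N k : ℕ) (t : Fin N) (j : Fin 4) :
    (columnLabel N k t j : ℤ) = k * (![1, (N : ℤ) + 1, 3 * N, 4 * N] j + rowSign j * (t : ℕ)) := by
  have ht := t.isLt
  have h3 : ((3 * N - (t : ℕ) : ℕ) : ℤ) = 3 * N - (t : ℕ) := by omega
  have h4 : ((4 * N - (t : ℕ) : ℕ) : ℤ) = 4 * N - (t : ℕ) := by omega
  fin_cases j <;> simp [columnLabel, rowSign, h3, h4] <;> ring_nf <;> simp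

theorem columnLabel_mem_Icc {N k : ℕ} (hk : 0 < k) (t : Fin N) (j : Fin 4) :
    columnLabel N k t j ∈ Icc 1 (k * (4 * N)) := by
  have ht := t.isLt
  have h : 1 ≤ ![(t : ℕ) + 1, N + t + 1, 3 * N - t, 4 * N - t] j ∧
      ![(t : ℕ) + 1, N + t + 1, 3 * N - t, 4 * N - t] j ≤ 4 * N := by
    fin_cases j <;> simp <;> omega
  rw [mem_Icc]
  exact ⟨Nat.mul_pos hk h.1, Nat.mul_le_mul_left k h.2⟩

/-- As `t` varies, the four entries sweep out the consecutive blocks of length `N` in `1, ..., 4 *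
N`, the last two in reverse. -/
theorem columnLabel_injective {N k : ℕ} (hk : 0 < k) :
    Function.Injective fun p : Fin N × Fin 4 => columnLabel N k p.1 p.2 := by
  rintro ⟨t, j⟩ ⟨t', j'⟩ h
  have ht := t.isLt
  have ht' := t'.isLt
  have h' := Nat.eq_of_mul_eq_mul_left hk h
  rw [Prod.mk.injEq, Fin.ext_iff]
  fin_cases j <;> fin_cases j' <;> simp at h' ⊢ <;> omega

end Labels

/-! ### Numerical estimates and extraction of the rows -/

section Assembly

variable {V : Type*} [Fintype V] [DecidableEq V]

/-- Here `s * s` is the modulus `k`, and the bracket adds the row and column bounds of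
`exists_perm_injective` for `q = 28`, so their sum can serve as `K`. After multiplication by `s` the
left side is at most `10 ^ 6 * N ^ 2`, and `N ^ 2 ≤ 2 * (N * (N - 1))`. -/
theorem separation_arith {s N n A B c : ℕ} (hs : s = 10 ^ 7) (hN : 2 ≤ N) (hn : n ≤ 28 * N)
    (hA : s * s * A ≤ 16 * n ^ 2) (hB : s * s * B ≤ 16 * (28 * n)) (hc : s * c ≤ 4 * n) :
    16 * (N * (3 * 28 * c) + (2 * A + N * (2 * 28 * c + B))) ≤ N * (N - 1) := by
  have hs0 : 0 < s := by rw [hs]; norm_num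
  have hn2 : n ^ 2 ≤ 784 * N ^ 2 := by nlinarith
  have hA' : s * A ≤ 12544 * N ^ 2 := by
    have : s * A ≤ s * (s * A) := Nat.le_mul_of_pos_left _ hs0
    nlinarith
  have hB' : s * B ≤ 12544 * N := by
    have : s * B ≤ s * (s * B) := Nat.le_mul_of_pos_left _ hs0
    nlinarith
  have hc' : s * c ≤ 112 * N := by omega
  have hcN : N * (s * c) ≤ 112 * N ^ 2 := by nlinarith
  have hBN : N * (s * B) ≤ 12544 * N ^ 2 := by nlinarith
  refine Nat.le_of_mul_le_mul_left ?_ hs0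
  have h1 : N ^ 2 ≤ 2 * (N * (N - 1)) := by
    obtain ⟨M, rfl⟩ : ∃ M, N = M + 2 := ⟨N - 2, by omega⟩
    simp only [Nat.add_succ_sub_one]
    nlinarith
  calc s * (16 * (N * (3 * 28 * c) + (2 * A + N * (2 * 28 * c + B))))
      = 2240 * (N * (s * c)) + 32 * (s * A) + 16 * (N * (s * B)) := by ring
    _ ≤ 2240 * (112 * N ^ 2) + 32 * (12544 * N ^ 2) + 16 * (12544 * N ^ 2) := by
        gcongr
    _ ≤ 10 ^ 6 * N ^ 2 := by nlinarith
    _ ≤ 10 ^ 6 * (2 * (N * (N - 1))) := Nat.mul_le_mul_left _ h1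
    _ ≤ s * (N * (N - 1)) := by
        rw [hs, ← mul_assoc]
        exact Nat.mul_le_mul_right _ (by norm_num)

/-- The data extracted from a graph of large minimum degree: rows of movable edges, each vertex
being affected by the row `ρ v` only, such that the remaining edges still separate vertices. -/
theorem exists_rows_of_minDegree (G : SimpleGraph V) [DecidableRel G.Adj]
    (hn : 28 < Fintype.card V) (hG : ∀ v, 6 ≤ G.degree v) :
    ∃ (N : ℕ) (ε : Fin N → Fin 4 → Sym2 V) (ρ : V → Fin N), 2 ≤ N ∧ 4 * N ≤ Fintype.card V ∧
      Fintype.card V ≤ 28 * N ∧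
      (∀ i j, ε i j ∈ G.edgeFinset) ∧
      (Function.Injective fun p : Fin N × Fin 4 => ε p.1 p.2) ∧
      (∀ v i, i ≠ ρ v → rowEffect (ε i) v = 0) ∧
      (∀ u v, rowEffect (ε (ρ u)) u = 0 → rowEffect (ε (ρ v)) v = 0 → ρ u = ρ v) ∧
      (∀ i, #{v | ρ v = i} ≤ 28) ∧
      ∀ u v, u ≠ v → ∃ e ∈ G.edgeFinset, (∀ i j, ε i j ≠ e) ∧ u ∈ e ∧ v ∉ e := by
  classical
  obtain ⟨e, he, hinc⟩ := G.exists_injective_incident hG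
  have hedge : ∀ p, e p ∈ G.edgeSet := fun p => ((G.mem_incidenceFinset _ _).1 (hinc p)).1
  have hmem : ∀ p : V × Fin 3, p.1 ∈ e p := fun p => ((G.mem_incidenceFinset _ _).1 (hinc p)).2
  -- Rows use only the edges of index `0`; the private edges of index `1` and `2` remain for
  -- separating vertices.
  let H : SimpleGraph V := SimpleGraph.fromEdgeSet (Set.range fun v => e (v, 0))
  have hHmem : ∀ x, x ∈ H.edgeSet → ∃ v, e (v, 0) = x := by
    intro x hx
    rw [SimpleGraph.edgeSet_fromEdgeSet] at hx
    exact hx.1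
  have hH : ∀ v, ∃ u, H.Adj v u := by
    intro v
    obtain ⟨u, hu⟩ := Sym2.mem_iff_exists.1 (hmem (v, 0))
    refine ⟨u, (SimpleGraph.fromEdgeSet_adj _).2 ⟨⟨v, hu⟩, ?_⟩⟩
    have := hedge (v, 0)
    rw [hu] at this
    exact (SimpleGraph.mem_edgeSet G).1 this |>.ne
  obtain ⟨N, ε, hεH, hεinj, huniq, hstat⟩ := exists_rowSystem H hH
  choose w hw using fun i j => hHmem _ (hεH i j)
  have hNpos : 0 < N := by
    rcases Nat.eq_zero_or_pos N with rfl | h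
    · have : #{v : V | ∀ i : Fin 0, rowEffect (ε i) v = 0} = Fintype.card V := by
        simp [Finset.card_univ]
      omega
    · exact h
  let i₀ : Fin N := ⟨0, hNpos⟩
  let ρ : V → Fin N := fun v =>
    if h : ∃ i, rowEffect (ε i) v ≠ 0 then h.choose else i₀
  have hρ : ∀ v i, rowEffect (ε i) v ≠ 0 → ρ v = i := by
    intro v i hi
    have h : ∃ i, rowEffect (ε i) v ≠ 0 := ⟨i, hi⟩
    simp only [ρ, dif_pos h]
    exact huniq v _ _ h.choose_spec hi
  have hρ' : ∀ v, rowEffect (ε (ρ v)) v = 0 → ρ v = i₀ ∧ ∀ i, rowEffect (ε i) v = 0 := by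
    intro v hv
    have h : ¬ ∃ i, rowEffect (ε i) v ≠ 0 := by
      rintro ⟨i, hi⟩
      rw [hρ v i hi] at hv
      exact hi hv
    exact ⟨by simp only [ρ, dif_neg h], by simpa using h⟩
  -- Four edges have at most eight ends, and the at most twenty unaffected vertices are all parked
  -- in row `i₀`.
  have hfib : ∀ i, #{v | ρ v = i} ≤ 28 := by
    intro i
    have hsub : (univ.filter fun v => ρ v = i) ⊆
        (List.ofFn (ε i)).toFinset.biUnion Sym2.toFinset ∪
          univ.filter fun v => ∀ i, rowEffect (ε i) v = 0 := by
      intro v hv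
      simp only [mem_filter, mem_univ, true_and] at hv
      by_cases h : rowEffect (ε i) v = 0
      · refine mem_union_right _ ?_
        subst hv
        simpa using (hρ' v h).2
      · obtain ⟨j, hj⟩ := exists_mem_of_rowEffect_ne_zero h
        refine mem_union_left _ (mem_biUnion.2 ⟨ε i j, ?_, Sym2.mem_toFinset.2 hj⟩)
        exact List.mem_toFinset.2 (List.mem_ofFn.2 ⟨j, rfl⟩)
    have h1 := (Finset.card_le_card hsub).trans (Finset.card_union_le _ _)
    have h2 := card_biUnion_sym2_toFinset_le (List.ofFn (ε i))
    rw [List.length_ofFn] at h2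
    omega
  have hcard : Fintype.card V ≤ 28 * N := by
    have := Finset.card_le_mul_card_image_of_maps_to (s := (univ : Finset V)) (t := univ) (f := ρ)
      (fun _ _ => mem_univ _) 28 (fun i _ => hfib i)
    simpa using this
  have hεinj' : Function.Injective fun p : Fin N × Fin 4 => ε p.1 p.2 := fun p p' h =>
    Prod.ext (hεinj _ _ _ _ h).1 (hεinj _ _ _ _ h).2
  refine ⟨N, ε, ρ, by omega, ?_, hcard, ?_, hεinj', ?_, ?_, hfib, ?_⟩
  · have := Fintype.card_le_of_injective (fun p : Fin N × Fin 4 => w p.1 p.2) (by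
      intro p p' h
      apply hεinj'
      change w p.1 p.2 = w p'.1 p'.2 at h
      change ε p.1 p.2 = ε p'.1 p'.2
      rw [← hw, ← hw, h])
    simp only [Fintype.card_prod, Fintype.card_fin] at this
    omega
  · intro i j
    rw [SimpleGraph.mem_edgeFinset, ← hw i j]
    exact hedge _
  · intro v i hi
    by_contra h
    exact hi (hρ v i h).symm
  · intro u v hu hv
    rw [(hρ' u hu).1, (hρ' v hv).1]
  · intro u v huv
    have hflex : ∀ l : Fin 3, l ≠ 0 → ∀ i j, ε i j ≠ e (u, l) := by
      intro l hl i j h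
      rw [← hw i j] at h
      exact hl (Prod.mk.inj (he h)).2.symm
    -- At most one of the two distinct remaining edges at `u` can be the edge `uv`; the other one
    -- separates.
    by_cases h : v ∈ e (u, 1)
    · refine ⟨e (u, 2), by simpa using hedge _, hflex 2 (by decide), hmem (u, 2), fun h2 => ?_⟩
      have e1 := (Sym2.mem_and_mem_iff huv).1 ⟨hmem (u, 1), h⟩
      have e2 := (Sym2.mem_and_mem_iff huv).1 ⟨hmem (u, 2), h2⟩
      have := (Prod.mk.inj (he (e1.trans e2.symm))).2
      exact absurd this (by decide)
    · exact ⟨e (u, 1), by simpa using hedge _, hflex 1 (by decide), hmem (u, 1), h⟩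

end Assembly

/-! ### Assembling the labeling -/

section Main

variable {V : Type*} [Fintype V] [DecidableEq V]

theorem SimpleGraph.vertexSum_eq_sum_incidence (G : SimpleGraph V) [DecidableRel G.Adj]
    (f : Sym2 V → ℕ) (v : V) :
    (G.vertexSum f v : ℤ) = ∑ e ∈ G.edgeFinset, incidence v e * f e := by
  have : G.incidenceFinset v = G.edgeFinset.filter fun e => v ∈ e := by
    ext e
    simp [SimpleGraph.incidenceSet]
  rw [SimpleGraph.vertexSum, this, Finset.sum_filter]
  push_cast
  refine Finset.sum_congr rfl fun e _ => ?_
  by_cases h : v ∈ e <;> simp [incidence, h]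

/-- Labels for the movable edges `ε i j` and for the other edges combine to a labeling of the
whole graph. -/
theorem SimpleGraph.exists_labeling (G : SimpleGraph V) [DecidableRel G.Adj] {N : ℕ}
    (ε : Fin N → Fin 4 → Sym2 V) (hε : ∀ i j, ε i j ∈ G.edgeFinset)
    (hεinj : Function.Injective fun p : Fin N × Fin 4 => ε p.1 p.2)
    (ℓ : Fin N × Fin 4 → ℕ) (hℓ : Function.Injective ℓ) (hℓm : ∀ p, ℓ p ∈ Icc 1 #G.edgeFinset)
    (g : {e // e ∈ G.edgeFinset ∧ ∀ i j, ε i j ≠ e} → ℕ) (hg : Function.Injective g)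
    (hgm : ∀ a, g a ∈ Icc 1 #G.edgeFinset) (hgℓ : ∀ a p, g a ≠ ℓ p) :
    ∃ f : Sym2 V → ℕ, Set.BijOn f G.edgeSet (Set.Icc 1 #G.edgeFinset) ∧
      ∀ v, (G.vertexSum f v : ℤ) = ∑ i, ∑ j, incidence v (ε i j) * ℓ (i, j) +
        ∑ a, incidence v a.1 * g a := by
  classical
  let f : Sym2 V → ℕ := fun e =>
    if h : ∃ p : Fin N × Fin 4, ε p.1 p.2 = e then ℓ h.choose
    else if h' : e ∈ G.edgeFinset ∧ ∀ i j, ε i j ≠ e then g ⟨e, h'⟩ else 0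
  have hfε : ∀ p : Fin N × Fin 4, f (ε p.1 p.2) = ℓ p := by
    intro p
    have h : ∃ p' : Fin N × Fin 4, ε p'.1 p'.2 = ε p.1 p.2 := ⟨p, rfl⟩
    simp only [f, dif_pos h]
    exact congrArg ℓ (hεinj h.choose_spec)
  have hfg : ∀ a : {e // e ∈ G.edgeFinset ∧ ∀ i j, ε i j ≠ e}, f a.1 = g a := by
    intro a
    have h : ¬ ∃ p : Fin N × Fin 4, ε p.1 p.2 = a.1 := by
      rintro ⟨p, hp⟩
      exact a.2.2 _ _ hp
    simp only [f, dif_neg h, dif_pos a.2]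
  have hcases : ∀ e ∈ G.edgeFinset, (∃ p : Fin N × Fin 4, ε p.1 p.2 = e) ∨
      ∃ a : {e // e ∈ G.edgeFinset ∧ ∀ i j, ε i j ≠ e}, a.1 = e := by
    intro e he
    by_cases h : ∃ p : Fin N × Fin 4, ε p.1 p.2 = e
    · exact Or.inl h
    · exact Or.inr ⟨⟨e, he, fun i j hij => h ⟨(i, j), hij⟩⟩, rfl⟩
  have hmaps : Set.MapsTo f G.edgeFinset (Icc 1 #G.edgeFinset : Finset ℕ) := by
    intro e he
    rcases hcases e he with ⟨p, rfl⟩ | ⟨a, rfl⟩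
    · rw [hfε]; exact hℓm p
    · rw [hfg]; exact hgm a
  have hinj : Set.InjOn f G.edgeFinset := by
    intro e he e' he' h
    rcases hcases e he with ⟨p, rfl⟩ | ⟨a, rfl⟩ <;>
      rcases hcases e' he' with ⟨p', rfl⟩ | ⟨a', rfl⟩
    · rw [hfε, hfε] at h
      rw [hℓ h]
    · rw [hfε, hfg] at h
      exact absurd h.symm (hgℓ _ _)
    · rw [hfε, hfg] at h
      exact absurd h (hgℓ _ _)
    · rw [hfg, hfg] at h
      rw [hg h]
  refine ⟨f, ?_, fun v => ?_⟩
  · have hsurj := Finset.surjOn_of_injOn_of_card_le f hmaps hinj (by simp)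
    have hbij : Set.BijOn f G.edgeFinset (Icc 1 #G.edgeFinset : Finset ℕ) := ⟨hmaps, hinj, hsurj⟩
    simpa using hbij
  · rw [G.vertexSum_eq_sum_incidence,
      ← Finset.sum_filter_add_sum_filter_not G.edgeFinset
        (fun e => ∃ p : Fin N × Fin 4, ε p.1 p.2 = e)]
    congr 1
    · rw [← Fintype.sum_prod_type' (f := fun i j => incidence v (ε i j) * (ℓ (i, j) : ℤ))]
      symm
      refine Finset.sum_bij (fun p _ => ε p.1 p.2) ?_ ?_ ?_ ?_
      · intro p _
        exact mem_filter.2 ⟨hε _ _, p, rfl⟩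
      · intro p _ p' _ h
        exact hεinj h
      · intro e he
        obtain ⟨p, hp⟩ := (mem_filter.1 he).2
        exact ⟨p, mem_univ _, hp⟩
      · intro p _
        rw [hfε]
    · symm
      refine Finset.sum_bij (fun a _ => a.1) ?_ ?_ ?_ ?_
      · intro a _
        refine mem_filter.2 ⟨a.2.1, ?_⟩
        rintro ⟨p, hp⟩
        exact a.2.2 _ _ hp
      · intro a _ a' _ h
        exact Subtype.ext h
      · intro e he
        obtain ⟨he, hp⟩ := mem_filter.1 he
        exact ⟨⟨e, he, fun i j hij => hp ⟨(i, j), hij⟩⟩, mem_univ _, rfl⟩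
      · intro a _
        rw [hfg]

/-- Graphs whose minimum degree exceeds an absolute constant are antimagic. -/
theorem SimpleGraph.isAntimagic_of_forall_le_degree (G : SimpleGraph V) [DecidableRel G.Adj]
    [Nonempty V] (hG : ∀ v, 10 ^ 15 ≤ G.degree v) : G.IsAntimagic := by
  classical
  set n := Fintype.card V with hn
  set m := #G.edgeFinset with hm
  have hnD : 10 ^ 15 < n := by
    obtain ⟨v⟩ := ‹Nonempty V›
    exact (hG v).trans_lt (G.degree_lt_card_verts v)
  have hmn : 10 ^ 14 * (5 * n) ≤ m := by
    have h1 := G.sum_degrees_eq_twice_card_edges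
    have h2 := Finset.card_nsmul_le_sum (univ : Finset V) (fun v => G.degree v) _ fun v _ => hG v
    rw [smul_eq_mul, Finset.card_univ, ← hn, h1, ← hm] at h2
    omega
  obtain ⟨N, ε, ρ, hN2, h4N, hn28, hε, hεinj, hρ, hstat, hfib, hsep⟩ :=
    exists_rows_of_minDegree G (by omega) (fun v => le_trans (by norm_num) (hG v))
  obtain ⟨s, hs⟩ : ∃ s : ℕ, s = 10 ^ 7 := ⟨_, rfl⟩
  -- The modulus is a square so that the bound on all coincidences yields, by a square root, at most
  -- `4 * n / s` coincidences per vertex.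
  obtain ⟨k, hk⟩ : ∃ k : ℕ, k = s * s := ⟨_, rfl⟩
  have hk14 : k = 10 ^ 14 := by rw [hk, hs]; norm_num
  have hkpos : 0 < k := by rw [hk14]; norm_num
  have hk4N : k * (4 * N) ≤ m := by
    calc k * (4 * N) ≤ k * (5 * n) := Nat.mul_le_mul_left _ (by omega)
      _ ≤ m := by rw [hk14]; exact hmn
  let α := {e // e ∈ G.edgeFinset ∧ ∀ i j, ε i j ≠ e}
  have hα : Fintype.card α + 4 * N = m := by
    have h1 : Fintype.card α = #(G.edgeFinset.filter fun e => ∀ i j, ε i j ≠ e) := by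
      rw [Fintype.card_subtype]
      congr 1
      ext e
      simp
    have h2 : #(G.edgeFinset.filter fun e => ¬ ∀ i j, ε i j ≠ e) = 4 * N := by
      have h3 : (G.edgeFinset.filter fun e => ¬ ∀ i j, ε i j ≠ e) =
          univ.image fun p : Fin N × Fin 4 => ε p.1 p.2 := by
        ext e
        simp only [mem_filter, mem_image, mem_univ, true_and, not_forall, not_not, Prod.exists]
        constructor
        · exact fun h => h.2
        · rintro ⟨i, j, rfl⟩
          exact ⟨hε i j, i, j, rfl⟩
      rw [h3, Finset.card_image_of_injective _ hεinj]
      simp [mul_comm]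
    rw [h1, ← h2, Finset.card_filter_add_card_filter_not]
  let L : Finset ℕ := univ.image fun p : Fin N × Fin 4 => columnLabel N k p.1 p.2
  have hLsub : L ⊆ Icc 1 m := by
    intro x hx
    obtain ⟨p, -, rfl⟩ := mem_image.1 hx
    have := mem_Icc.1 (columnLabel_mem_Icc hkpos p.1 p.2)
    exact mem_Icc.2 ⟨this.1, this.2.trans hk4N⟩
  have hLcard : #L = 4 * N := by
    rw [Finset.card_image_of_injective _ (columnLabel_injective hkpos)]
    simp [mul_comm]
  have hcard : Fintype.card α = Fintype.card (Icc 1 m \ L : Finset ℕ) := by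
    rw [Fintype.card_coe, Finset.card_sdiff_of_subset hLsub, hLcard, Nat.card_Icc]
    omega
  let g₀ : α ≃ (Icc 1 m \ L : Finset ℕ) := Fintype.equivOfCardEq hcard
  have hg₀ : ∀ a, ((g₀ a : ℕ) ∈ Icc 1 m) ∧ (g₀ a : ℕ) ∉ L := fun a => mem_sdiff.1 (g₀ a).2
  -- This is the contribution of the row labels that does not depend on the column index; including
  -- it in `W` leaves only the term moved by `π`.
  let κ : V → ℤ := fun v => k * ∑ i, ∑ j, incidence v (ε i j) * ![1, (N : ℤ) + 1, 3 * N, 4 * N] j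
  obtain ⟨τ, W, hW, hA, hB, hC⟩ := exists_perm_few_coincidences (α := α)
    (fun a => ((g₀ a : ℕ) : ℤ))
    (fun a b h => g₀.injective (Subtype.ext (Nat.cast_injective (R := ℤ) h)))
    m k 28 (fun a => by
      have := mem_Icc.1 (hg₀ a).1
      exact ⟨by exact_mod_cast this.1, by exact_mod_cast this.2⟩)
    (by rw [hk14]; omega) (fun v a => incidence v a.1) κ ρ (fun v => hfib (ρ v))
    (by
      intro u v huv
      obtain ⟨e, he, hne, hu, hv⟩ := hsep u v huv
      exact ⟨⟨e, he, hne⟩, by simp [incidence, hu, hv]⟩)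
    (by
      intro u v
      have h1 := Finset.card_filter_add_card_filter_not (s := (univ : Finset α))
        (fun b => incidence u b.1 - incidence v b.1 = 0)
      -- Only edges at `u` or `v` have nonzero coefficient, fewer than `2 * n` of them, and `4 * N ≤
      -- n` edges are movable. Both are negligible against `m`.
      have h2 : #{b : α | ¬ (incidence u b.1 - incidence v b.1 = 0)} ≤
          #(G.incidenceFinset u ∪ G.incidenceFinset v) := by
        refine Finset.card_le_card_of_injOn Subtype.val ?_ Subtype.val_injective.injOn
        intro b hb
        simp only [coe_filter, mem_univ, true_and, Set.mem_ofPred_eq] at hb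
        have hbE := SimpleGraph.mem_edgeFinset.1 b.2.1
        simp only [coe_union, Set.mem_union, mem_coe, SimpleGraph.mem_incidenceFinset,
          SimpleGraph.incidenceSet, Set.mem_sep_iff]
        by_contra h
        push Not at h
        exact hb (by simp [incidence, h.1 hbE, h.2 hbE])
      have h3 := Finset.card_union_le (G.incidenceFinset u) (G.incidenceFinset v)
      rw [G.card_incidenceFinset_eq_degree, G.card_incidenceFinset_eq_degree] at h3
      have h4 := G.degree_lt_card_verts u
      have h5 := G.degree_lt_card_verts v
      rw [Finset.card_univ] at h1
      omega)
    (by omega)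
  let c := 4 * n / s
  have hspos : 0 < s := by rw [hs]; norm_num
  have hc : ∀ u, #{v | u ≠ v ∧ (k : ℤ) ∣ W u - W v} ≤ c := by
    intro u
    rw [Nat.le_div_iff_mul_le hspos]
    refine (Nat.pow_le_pow_iff_left (n := 2) (by norm_num)).1 ?_
    have h1 := sq_card_coincidences_le (k : ℤ) W u
    calc _ = k * #{v | u ≠ v ∧ (k : ℤ) ∣ W u - W v} ^ 2 := by rw [hk]; ring
      _ ≤ k * #{p : V × V | p.1 ≠ p.2 ∧ (k : ℤ) ∣ W p.1 - W p.2} := Nat.mul_le_mul_left _ h1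
      _ ≤ 16 * n ^ 2 := hA
      _ = (4 * n) ^ 2 := by ring
  rw [hk] at hA hB
  have harith := separation_arith hs hN2 hn28 hA hB (Nat.mul_div_le (4 * n) s)
  rw [← hk] at harith
  obtain ⟨π, hπ⟩ := exists_perm_injective hN2 (k : ℤ) (by exact_mod_cast hkpos.ne') ρ
    (fun v => rowEffect (ε (ρ v)) v) W 28 _ _ c _ hfib hstat hC le_rfl le_rfl hc
    (Nat.le_add_right _ _) (Nat.le_add_left _ _) harith
  obtain ⟨f, hf, hsum⟩ := G.exists_labeling ε hε hεinj
    (fun p => columnLabel N k (π p.1) p.2) (by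
      rintro ⟨i, j⟩ ⟨i', j'⟩ h
      have := columnLabel_injective hkpos (a₁ := (π i, j)) (a₂ := (π i', j')) h
      simpa using this)
    (fun p => hLsub (mem_image.2 ⟨(π p.1, p.2), mem_univ _, rfl⟩))
    (fun a => g₀ (τ a)) (fun a b h => τ.injective (g₀.injective (Subtype.ext h)))
    (fun a => (hg₀ _).1)
    (fun a p h => (hg₀ (τ a)).2 (h ▸ mem_image.2 ⟨(π p.1, p.2), mem_univ _, rfl⟩))
  refine ⟨f, hf, fun u v huv => hπ ?_⟩
  have key : ∀ v, (G.vertexSum f v : ℤ) =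
      W v + k * rowEffect (ε (ρ v)) v * ((π (ρ v) : ℕ) : ℤ) := by
    intro v
    have hrow : ∑ i, rowEffect (ε i) v * ((π i : ℕ) : ℤ) =
        rowEffect (ε (ρ v)) v * ((π (ρ v) : ℕ) : ℤ) :=
      Finset.sum_eq_single (ρ v) (fun i _ hi => by rw [hρ v i hi, zero_mul])
        (fun h => absurd (mem_univ _) h)
    rw [hsum v, hW v, mul_assoc, ← hrow]
    simp only [κ, rowEffect, columnLabel_eq]
    have : ∀ i, ∑ j, incidence v (ε i j) *
          ((k : ℤ) * (![1, (N : ℤ) + 1, 3 * N, 4 * N] j + rowSign j * ((π i : ℕ) : ℤ))) =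
        k * ∑ j, incidence v (ε i j) * ![1, (N : ℤ) + 1, 3 * N, 4 * N] j +
          k * ((∑ j, rowSign j * incidence v (ε i j)) * ((π i : ℕ) : ℤ)) := by
      intro i
      rw [Finset.sum_mul, Finset.mul_sum, Finset.mul_sum, ← Finset.sum_add_distrib]
      exact Finset.sum_congr rfl fun j _ => by ring
    rw [Finset.sum_congr rfl fun i _ => this i, Finset.sum_add_distrib, ← Finset.mul_sum,
      ← Finset.mul_sum]
    ring
  have h' : (G.vertexSum f u : ℤ) = G.vertexSum f v := by exact_mod_cast huv
  rw [key, key] at h'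
  exact h'

theorem SimpleGraph.isAntimagic_of_subsingleton [Subsingleton V] (G : SimpleGraph V)
    [DecidableRel G.Adj] : G.IsAntimagic := by
  have hE : G.edgeFinset = ∅ := by
    rw [SimpleGraph.edgeFinset_eq_empty]
    exact Subsingleton.elim _ _
  have hE' : G.edgeSet = ∅ := by
    rw [← SimpleGraph.coe_edgeFinset, hE, Finset.coe_empty]
  refine ⟨fun _ => 0, ?_, Function.injective_of_subsingleton _⟩
  rw [hE, hE']
  simp

end Main

/-- For at least two vertices `log n ≥ log 2`, so this choice of `C` forces minimum degree `10 ^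
15`. With at most one vertex the logarithm is zero and the hypothesis says nothing, so that case is
settled directly. -/
theorem theorem1 :
    ∃ C : ℝ, ∀ (V : Type*) [Fintype V] [DecidableEq V] (G : SimpleGraph V) [DecidableRel G.Adj],
      C * Real.log (Fintype.card V : ℝ) ≤ (G.minDegree : ℝ) → G.IsAntimagic := by
  refine ⟨10 ^ 15 / Real.log 2, ?_⟩
  intro V _ _ G _ h
  rcases Nat.lt_or_ge 1 (Fintype.card V) with hn | hn
  · have : Nonempty V := Fintype.card_pos_iff.1 (by omega)
    refine G.isAntimagic_of_forall_le_degree fun v => le_trans ?_ (G.minDegree_le_degree v)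
    have hlog2 : 0 < Real.log 2 := Real.log_pos (by norm_num)
    have hlog : Real.log 2 ≤ Real.log (Fintype.card V : ℝ) :=
      Real.log_le_log (by norm_num) (by exact_mod_cast hn)
    have h1 : (10 ^ 15 : ℝ) ≤ G.minDegree := by
      refine le_trans ?_ h
      calc (10 ^ 15 : ℝ) = 10 ^ 15 / Real.log 2 * Real.log 2 := by field_simp
        _ ≤ _ := by gcongr
    exact_mod_cast h1
  · have : Subsingleton V := Fintype.card_le_one_iff_subsingleton.1 hn
    exact G.isAntimagic_of_subsingleton
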